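/- Let $\kappa<0$, $\tau\neq 0$ be real numbers. Let $\mathrm{Sl}(2,\mathbb{R})=\{(z,w)\in\mathbb{C}^2:\ |z|^2-|w|^2=1\}$ with the global frame $E^1=(\bar w,\bar z)$, $E^2=(i\bar w,i\bar z)$, $V=(iz,iw)$ and with the Riemannian metric $g$ for which this frame is orthogonal and $g(E^1,E^1)=g(E^2,E^2)=-\frac{4}{\kappa}$, $g(V,V)=\frac{16\tau^2}{\kappa^2}$. The mean curvature of an immersed surface is half the trace of its second fundamental form. Let $H>0$ satisfy $4H^2+\kappa>0$, put $a=\operatorname{arctanh}\bigl(\sqrt{-\kappa}/(2H)\bigr)$ and, for $0\le x\le a$, $$\rho(x)=\frac{\sqrt{1+\frac{4H^2}{\kappa}\tanh^2x}}{\sqrt{1-\frac{4\tau^2}{\kappa}\tanh^2x}},\qquad y(x)=\arctan\Bigl(\frac{\tau}{H}\rho(x)\Bigr)-\frac{H}{\tau}\,\frac{\sqrt{4\tau^2-\kappa}}{\sqrt{4H^2+\kappa}}\arctan\Bigl(\frac{\sqrt{4\tau^2-\kappa}}{\sqrt{4H^2+\kappa}}\,\rho(x)\Bigr).$$ Define $\Phi:\,]-a,a[\,\times\,]-\pi,\pi[\,\to\mathrm{Sl}(2,\mathbb{R})$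 by $$\Phi(x,t)=\begin{cases}\bigl(\cosh(x+a)\,e^{iy(x+a)},\ \sinh(x+a)\,e^{it}\bigr),& x<0,\\ \bigl(\cosh(a-x)\,e^{-iy(a-x)},\ \sinh(a-x)\,e^{it}\bigr),& x\ge 0.\end{cases}$$ Then $\Phi$ defines an immersed sphere of constant mean curvature $H$. Precisely: there are an increasing homeomorphism $\varphi:\,]-a,a[\,\to\,]-\frac{\pi}{2},\frac{\pi}{2}[$, smooth with positive derivative on $]-a,0[\,\cup\,]0,a[$, and a smooth immersion $F:\mathbb{S}^2\to\mathrm{Sl}(2,\mathbb{R})$ of constant mean curvature $H$ (with respect to a suitable smooth unit normal field) such that $$F\bigl(\cos\varphi(x)\cos t,\ \cos\varphi(x)\sin t,\ \sin\varphi(x)\bigr)=\Phi(x,t)\quad\text{for all }x\in\,]-a,a[,\ t\in\,]-\pi,\pi[ .$$ Moreover, if $\tau>0$, then $F$ is an embedding if and only if $y(0)>-\pi$; if $\tau<0$, then $F$ is an embedding if and only if $y(0)<\pi$. -/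

import Mathlib

open scoped Manifold ContDiff

noncomputable section

namespace SlTwo

/-! ### The homogeneous space -/

/-- The special linear group, in the model `{(z, w) ∈ ℂ² : |z|² - |w|² = 1}`. -/
def carrier : Set (ℂ × ℂ) := {p | ‖p.1‖ ^ 2 - ‖p.2‖ ^ 2 = 1}

/-- The neutral real inner product `Re (z z̄') - Re (w w̄')` of `ℂ²`. -/
def neutral (X Y : ℂ × ℂ) : ℝ :=
  (X.1 * starRingEnd ℂ Y.1).re - (X.2 * starRingEnd ℂ Y.2).re

/-- `X` is tangent to `carrier` at `p`: the differential of `|z|² - |w|²` at `p` kills `X`. -/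
def IsTangent (p X : ℂ × ℂ) : Prop := neutral p X = 0

/-- The global frame `(E¹, E², V)` of `carrier`, as vector fields on `ℂ²`:
`E¹ = (w̄, z̄)`, `E² = (i w̄, i z̄)`, `V = (i z, i w)`. -/
def frame : Fin 3 → ℂ × ℂ → ℂ × ℂ :=
  ![fun p => (starRingEnd ℂ p.2, starRingEnd ℂ p.1),
    fun p => (Complex.I * starRingEnd ℂ p.2, Complex.I * starRingEnd ℂ p.1),
    fun p => (Complex.I * p.1, Complex.I * p.2)]

/-- The coordinates of a tangent vector `X` at `p` in the frame `(E¹, E², V)`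
(see `sum_frameCoord_smul`). -/
def frameCoord (p X : ℂ × ℂ) : Fin 3 → ℝ :=
  ![-neutral X (frame 0 p), -neutral X (frame 1 p), neutral X (frame 2 p)]

/-- The squared lengths of `E¹, E², V`. -/
def frameNormSq (κ τ : ℝ) : Fin 3 → ℝ := ![4 / (-κ), 4 / (-κ), 16 * τ ^ 2 / κ ^ 2]

/-- The Riemannian metric of `E(κ, τ)`, `κ < 0`, `τ ≠ 0`: the frame is orthogonal and its members
have squared lengths `frameNormSq κ τ`. -/
def metric (κ τ : ℝ) (p X Y : ℂ × ℂ) : ℝ :=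
  ∑ k, frameNormSq κ τ k * frameCoord p X k * frameCoord p Y k

/-- Coefficients of the Levi-Civita connection in the frame:
`∇_{e i} (e j) = ∑ k, conn κ τ i j k • e k`. See `conn_torsion_free` and `conn_metric`. -/
def conn (κ τ : ℝ) : Fin 3 → Fin 3 → Fin 3 → ℝ :=
  ![![![0, 0, 0], ![0, 0, 1], ![0, 4 * τ ^ 2 / κ, 0]],
    ![![0, 0, -1], ![0, 0, 0], ![-(4 * τ ^ 2 / κ), 0, 0]],
    ![![0, 4 * τ ^ 2 / κ - 2, 0], ![-(4 * τ ^ 2 / κ - 2), 0, 0], ![0, 0, 0]]]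

lemma frame_isTangent (p : ℂ × ℂ) (i : Fin 3) : IsTangent p (frame i p) := by
  fin_cases i <;> simp [IsTangent, neutral, frame] <;> ring

lemma frameCoord_frame {p : ℂ × ℂ} (hp : p ∈ carrier) (i k : Fin 3) :
    frameCoord p (frame i p) k = if k = i then 1 else 0 := by
  have h : p.1.re * p.1.re + p.1.im * p.1.im - (p.2.re * p.2.re + p.2.im * p.2.im) = 1 := by
    have := hp
    rw [carrier, Set.mem_ofPred_eq, Complex.sq_norm, Complex.sq_norm, Complex.normSq_apply,
      Complex.normSq_apply] at this
    exact this
  fin_cases i <;> fin_cases k <;> simp [frameCoord, neutral, frame] <;> linarith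

lemma sum_frameCoord_smul {p X : ℂ × ℂ} (hp : p ∈ carrier) (hX : IsTangent p X) :
    ∑ k, frameCoord p X k • frame k p = X := by
  have h : p.1.re * p.1.re + p.1.im * p.1.im - (p.2.re * p.2.re + p.2.im * p.2.im) = 1 := by
    have := hp
    rw [carrier, Set.mem_ofPred_eq, Complex.sq_norm, Complex.sq_norm, Complex.normSq_apply,
      Complex.normSq_apply] at this
    exact this
  have hX' : p.1.re * X.1.re + p.1.im * X.1.im - (p.2.re * X.2.re + p.2.im * X.2.im) = 0 := by
    have := hX
    simp [IsTangent, neutral] at this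
    linarith
  apply Prod.ext <;> apply Complex.ext <;>
    simp [Fin.sum_univ_three, frameCoord, neutral, frame]
  · linear_combination X.1.re * h - p.1.re * hX'
  · linear_combination X.1.im * h - p.1.im * hX'
  · linear_combination X.2.re * h - p.2.re * hX'
  · linear_combination X.2.im * h - p.2.im * hX'

lemma metric_frame (κ τ : ℝ) {p : ℂ × ℂ} (hp : p ∈ carrier) (i j : Fin 3) :
    metric κ τ p (frame i p) (frame j p) = if i = j then frameNormSq κ τ i else 0 := by
  simp only [metric, frameCoord_frame hp]
  fin_cases i <;> fin_cases j <;> simp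

/-- The connection is torsion free: `∇_{e i} (e j) - ∇_{e j} (e i) = [e i, e j]`. -/
lemma conn_torsion_free (κ τ : ℝ) (i j : Fin 3) (p : ℂ × ℂ) :
    ∑ k, (conn κ τ i j k - conn κ τ j i k) • frame k p =
      VectorField.lieBracket ℝ (frame i) (frame j) p := by
  have h0 : fderiv ℝ (frame 0) p = ((Complex.conjCLE : ℂ →L[ℝ] ℂ).comp
      (ContinuousLinearMap.snd ℝ ℂ ℂ)).prod
        ((Complex.conjCLE : ℂ →L[ℝ] ℂ).comp (ContinuousLinearMap.fst ℝ ℂ ℂ)) :=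
    (ContinuousLinearMap.hasFDerivAt (((Complex.conjCLE : ℂ →L[ℝ] ℂ).comp
      (ContinuousLinearMap.snd ℝ ℂ ℂ)).prod
        ((Complex.conjCLE : ℂ →L[ℝ] ℂ).comp (ContinuousLinearMap.fst ℝ ℂ ℂ)))).fderiv
  have h1 : fderiv ℝ (frame 1) p = (Complex.I • (Complex.conjCLE : ℂ →L[ℝ] ℂ).comp
      (ContinuousLinearMap.snd ℝ ℂ ℂ)).prod
        (Complex.I • (Complex.conjCLE : ℂ →L[ℝ] ℂ).comp (ContinuousLinearMap.fst ℝ ℂ ℂ)) :=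
    (ContinuousLinearMap.hasFDerivAt ((Complex.I • (Complex.conjCLE : ℂ →L[ℝ] ℂ).comp
      (ContinuousLinearMap.snd ℝ ℂ ℂ)).prod
        (Complex.I • (Complex.conjCLE : ℂ →L[ℝ] ℂ).comp (ContinuousLinearMap.fst ℝ ℂ ℂ)))).fderiv
  have h2 : fderiv ℝ (frame 2) p = (Complex.I • ContinuousLinearMap.fst ℝ ℂ ℂ).prod
      (Complex.I • ContinuousLinearMap.snd ℝ ℂ ℂ) :=
    (ContinuousLinearMap.hasFDerivAt ((Complex.I • ContinuousLinearMap.fst ℝ ℂ ℂ).prod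
      (Complex.I • ContinuousLinearMap.snd ℝ ℂ ℂ))).fderiv
  rw [VectorField.lieBracket_eq]
  fin_cases i <;> fin_cases j <;> apply Prod.ext <;> apply Complex.ext <;>
    simp [Fin.sum_univ_three, conn, h0, h1, h2] <;> simp [frame] <;> ring

/-- The connection is metric: `⟨∇_{e i} (e j), e k⟩ + ⟨e j, ∇_{e i} (e k)⟩ = 0`, the derivative of
the constant `⟨e j, e k⟩`. -/
lemma conn_metric {κ : ℝ} (τ : ℝ) (hκ : κ < 0) (i j k : Fin 3) :
    conn κ τ i j k * frameNormSq κ τ k + conn κ τ i k j * frameNormSq κ τ j = 0 := by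
  have h := hκ.ne
  fin_cases i <;> fin_cases j <;> fin_cases k <;> simp [conn, frameNormSq] <;> field_simp <;> ring

/-! ### Immersed spheres of constant mean curvature -/

/-- The unit sphere of `ℝ³`, with the smooth structure that Mathlib gives it. -/
abbrev Sphere : Type := Metric.sphere (0 : EuclideanSpace ℝ (Fin 3)) 1

/-- The differential at `p` of a map `F : 𝕊² → ℂ²`. -/
def differential (F : Sphere → ℂ × ℂ) (p : Sphere) (u : TangentSpace (𝓡 2) p) : ℂ × ℂ :=
  mfderiv (𝓡 2) 𝓘(ℝ, ℂ × ℂ) F p u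

/-- The derivative at `p` of a real function on the sphere in the direction `u`. -/
def dirDeriv (f : Sphere → ℝ) (p : Sphere) (u : TangentSpace (𝓡 2) p) : ℝ :=
  mfderiv (𝓡 2) 𝓘(ℝ, ℝ) f p u

/-- The covariant derivative `∇_u N` of a tangent field `N` along `F : 𝕊² → carrier`. Writing
`N = ∑ nₖ eₖ` and `dF u = ∑ aᵢ eᵢ`, it is `∑ₖ (d nₖ(u) + ∑ᵢⱼ aᵢ nⱼ Γᵢⱼₖ) eₖ`. -/
def covDeriv (κ τ : ℝ) (F N : Sphere → ℂ × ℂ) (p : Sphere) (u : TangentSpace (𝓡 2) p) : ℂ × ℂ :=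
  ∑ k, (dirDeriv (fun q => frameCoord (F q) (N q) k) p u +
    ∑ i, ∑ j, frameCoord (F p) (differential F p u) i * frameCoord (F p) (N p) j *
      conn κ τ i j k) • frame k (F p)

/-- The second fundamental form of `F` with respect to the unit normal field `N`,
`II(u, v) = -⟨∇_u N, dF v⟩`. -/
def secondFundamentalForm (κ τ : ℝ) (F N : Sphere → ℂ × ℂ) (p : Sphere)
    (u v : TangentSpace (𝓡 2) p) : ℝ :=
  -metric κ τ (F p) (covDeriv κ τ F N p u) (differential F p v)

/-- `F` is a smooth immersion of the sphere into `carrier`. -/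
def IsSmoothImmersion (F : Sphere → ℂ × ℂ) : Prop :=
  (∀ p, F p ∈ carrier) ∧ ContMDiff (𝓡 2) 𝓘(ℝ, ℂ × ℂ) ∞ F ∧
    ∀ p, Function.Injective (differential F p)

/-- `F` is a smooth embedding of the sphere into `carrier`. -/
def IsSmoothEmbedding (F : Sphere → ℂ × ℂ) : Prop :=
  IsSmoothImmersion F ∧ Topology.IsEmbedding F

/-- `N` is a smooth unit normal field along `F`. -/
def IsUnitNormal (κ τ : ℝ) (F N : Sphere → ℂ × ℂ) : Prop :=
  ContMDiff (𝓡 2) 𝓘(ℝ, ℂ × ℂ) ∞ N ∧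
    ∀ p, IsTangent (F p) (N p) ∧ metric κ τ (F p) (N p) (N p) = 1 ∧
      ∀ u, metric κ τ (F p) (N p) (differential F p u) = 0

/-- `F` has constant mean curvature `H` (half the trace of the second fundamental form, with
respect to the induced metric) for a suitable global choice of the unit normal field. -/
def HasMeanCurvature (κ τ H : ℝ) (F : Sphere → ℂ × ℂ) : Prop :=
  ∃ N, IsUnitNormal κ τ F N ∧ ∀ p, ∀ u v : TangentSpace (𝓡 2) p,
    metric κ τ (F p) (differential F p u) (differential F p u) = 1 →
    metric κ τ (F p) (differential F p v) (differential F p v) = 1 →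
    metric κ τ (F p) (differential F p u) (differential F p v) = 0 →
    (secondFundamentalForm κ τ F N p u u + secondFundamentalForm κ τ F N p v v) / 2 = H

/-! ### The explicit map -/

/-- `ρ(x) = √(1 + (4H²/κ) tanh² x) / √(1 - (4τ²/κ) tanh² x)`. -/
def rho (κ τ H x : ℝ) : ℝ :=
  Real.sqrt (1 + 4 * H ^ 2 / κ * Real.tanh x ^ 2) /
    Real.sqrt (1 - 4 * τ ^ 2 / κ * Real.tanh x ^ 2)

/-- The angle function `y`. -/
def yFun (κ τ H x : ℝ) : ℝ :=
  Real.arctan (τ / H * rho κ τ H x) -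
    H / τ * (Real.sqrt (4 * τ ^ 2 - κ) / Real.sqrt (4 * H ^ 2 + κ)) *
      Real.arctan (Real.sqrt (4 * τ ^ 2 - κ) / Real.sqrt (4 * H ^ 2 + κ) * rho κ τ H x)

/-- `a = artanh (√(-κ) / (2H))`. -/
def halfLength (κ H : ℝ) : ℝ := Real.artanh (Real.sqrt (-κ) / (2 * H))

/-- The piecewise map `Φ` of `(x, t) ∈ ]-a, a[ × ]-π, π[`. -/
def Phi (κ τ H x t : ℝ) : ℂ × ℂ :=
  if x < 0 then
    ((Real.cosh (x + halfLength κ H) : ℂ) *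
        Complex.exp (Complex.I * (yFun κ τ H (x + halfLength κ H) : ℂ)),
      (Real.sinh (x + halfLength κ H) : ℂ) * Complex.exp (Complex.I * (t : ℂ)))
  else
    ((Real.cosh (halfLength κ H - x) : ℂ) *
        Complex.exp (-(Complex.I * (yFun κ τ H (halfLength κ H - x) : ℂ))),
      (Real.sinh (halfLength κ H - x) : ℂ) * Complex.exp (Complex.I * (t : ℂ)))

/-- The point of the unit sphere with latitude `φ` and longitude `t`. -/
def latLong (φ t : ℝ) : Sphere :=
  ⟨!₂[Real.cos φ * Real.cos t, Real.cos φ * Real.sin t, Real.sin φ], by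
    rw [mem_sphere_zero_iff_norm, EuclideanSpace.norm_eq, Real.sqrt_eq_one]
    simp only [Fin.sum_univ_three, Real.norm_eq_abs, sq_abs]
    simp
    nlinarith [Real.sin_sq_add_cos_sq φ, Real.sin_sq_add_cos_sq t]⟩

/-- `φ` is an admissible latitude function on `]-a, a[`: an increasing homeomorphism onto
`]-π/2, π/2[` which is a diffeomorphism onto its image on each side of `0`. -/
def IsLatitude (a : ℝ) (φ : ℝ → ℝ) : Prop :=
  ContinuousOn φ (Set.Ioo (-a) a) ∧ StrictMonoOn φ (Set.Ioo (-a) a) ∧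
    φ '' Set.Ioo (-a) a = Set.Ioo (-(Real.pi / 2)) (Real.pi / 2) ∧
    ContDiffOn ℝ ∞ φ (Set.Ioo (-a) 0 ∪ Set.Ioo 0 a) ∧
    ∀ x ∈ Set.Ioo (-a) 0 ∪ Set.Ioo 0 a, 0 < deriv φ x

end SlTwo

end

/-! The signed height r = ±ρ(x) removes the case distinction in Φ. On ]0, a], cosh² x = 4(H² +
τ²r²)/D and sinh² x = -κ(1 - r²)/D with D = (4H² + κ) + (4τ² - κ)r², and y = Y ∘ ρ with Y = `angle`
smooth and odd. Since arctan(τr/H) is the argument of H + iτr, both branches of Φ come from one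
smooth map (x₀, x₁, x₂) ↦ (Z(x₂), W(x₂)(x₀ + i x₁)) restricted to the unit sphere, where Z = 2(H -
iτr)e^{iθ}/√D and W = √(-κ)/√D (`sphereMap_latLong`). The latitude is φ = arcsin r; it fails to be
smooth only at the equator, where ρ has a square-root zero.

For the curvature, write x₀ + i x₁ = sξ with |ξ| = 1, normalise the frame (E¹, E², V) and rotate its
horizontal part by ξe^{iθ}. In this frame the normal is (-s, 0, -r), and the differential of a
tangent vector with meridian and parallel components m, l is α(-r, 0, s) + β(0, 1, 0), where (m, l)
↦ (α, β) is linear and invertible (`coords_of_parts`). The induced metric is therefore α² + β², at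
the poles too, so the map is an immersion. The trace of the second fundamental form over an
orthonormal pair needs only Σα² = Σβ² = 1 and Σαβ = 0, and equals 2H (`hasMeanCurvature_sphereMap`).

For embeddedness, |w|² determines r², so distinct points can collide only at heights ±r, where z has
arguments ∓Y(r); they do collide, on a common meridian, when Y(r) is a multiple of π. As Y is odd
and strictly monotone, injectivity amounts to |Y(1)| < π, and Y(1) = y(0) has the sign of -τ.
Compactness of the sphere turns injectivity into embeddedness. -/

namespace SlTwo

open Real

variable {κ τ H : ℝ}

/-! ### The profile functions -/

/-- The common denominator `D(r) = (4H² + κ) + (4τ² - κ) r²` of the profile functions. -/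
noncomputable def profileDen (κ τ H r : ℝ) : ℝ := (4 * H ^ 2 + κ) + (4 * τ ^ 2 - κ) * r ^ 2

/-- The phase `θ(r)`. -/
noncomputable def phase (κ τ H r : ℝ) : ℝ :=
  H / τ * (√(4 * τ ^ 2 - κ) / √(4 * H ^ 2 + κ)) *
    arctan (√(4 * τ ^ 2 - κ) / √(4 * H ^ 2 + κ) * r)

/-- The function `Y` with `y = Y ∘ ρ`. -/
noncomputable def angle (κ τ H r : ℝ) : ℝ := arctan (τ / H * r) - phase κ τ H r

/-- The first component of the sphere at height `r`. -/
noncomputable def zProfile (κ τ H r : ℝ) : ℂ :=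
  ((2 / √(profileDen κ τ H r) : ℝ) : ℂ) * (H - Complex.I * τ * r) *
    Complex.exp (Complex.I * (phase κ τ H r : ℂ))

/-- The second component of the sphere at height `r` is `wProfile r * (x₁ + i x₂)`. -/
noncomputable def wProfile (κ τ H r : ℝ) : ℂ := ((√(-κ) / √(profileDen κ τ H r) : ℝ) : ℂ)

/-- The horizontal part of the normal at height `r` is `nuProfile r * (x₁ + i x₂)`. -/
noncomputable def nuProfile (κ τ H r : ℝ) : ℂ :=
  -((√(-κ) / 2 : ℝ) : ℂ) * Complex.exp (Complex.I * (phase κ τ H r : ℂ))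

lemma profileDen_pos (hκ : κ < 0) (hHκ : 0 < 4 * H ^ 2 + κ) (r : ℝ) :
    0 < profileDen κ τ H r := by
  have : 0 ≤ (4 * τ ^ 2 - κ) * r ^ 2 := mul_nonneg (by nlinarith [sq_nonneg τ]) (sq_nonneg r)
  rw [profileDen]; linarith

lemma yFun_eq (x : ℝ) : yFun κ τ H x = angle κ τ H (rho κ τ H x) := rfl

lemma phase_neg (r : ℝ) : phase κ τ H (-r) = -phase κ τ H r := by
  simp [phase, arctan_neg]

lemma angle_neg (r : ℝ) : angle κ τ H (-r) = -angle κ τ H r := by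
  simp only [angle, phase_neg, mul_neg, arctan_neg]; ring

lemma angle_zero : angle κ τ H 0 = 0 := by simp [angle, phase]

/-- The ratio of square roots occurs both before and inside the arctangent, so only its square
survives and θ' is rational in r. -/
lemma hasDerivAt_phase (hκ : κ < 0) (hτ : τ ≠ 0) (hHκ : 0 < 4 * H ^ 2 + κ) (r : ℝ) :
    HasDerivAt (phase κ τ H) (H * (4 * τ ^ 2 - κ) / (τ * profileDen κ τ H r)) r := by
  have hD := profileDen_pos (τ := τ) hκ hHκ r
  have hg : 0 < 4 * τ ^ 2 - κ := by nlinarith [sq_nonneg τ]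
  set d := √(4 * τ ^ 2 - κ) / √(4 * H ^ 2 + κ) with hd
  have hd2 : d ^ 2 = (4 * τ ^ 2 - κ) / (4 * H ^ 2 + κ) := by
    rw [hd, div_pow, sq_sqrt hg.le, sq_sqrt hHκ.le]
  have h1 : HasDerivAt (fun r : ℝ => d * r) d r := by
    simpa using (hasDerivAt_id r).const_mul d
  have h := (h1.arctan).const_mul (H / τ * d)
  refine h.congr_deriv ?_
  have h2 : 1 + (d * r) ^ 2 = profileDen κ τ H r / (4 * H ^ 2 + κ) := by
    rw [mul_pow, hd2, profileDen]; field_simp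
  rw [h2]
  calc _ = H / τ * d ^ 2 * (4 * H ^ 2 + κ) / profileDen κ τ H r := by field_simp
    _ = _ := by rw [hd2, mul_assoc (H / τ), div_mul_cancel₀ _ hHκ.ne']; field_simp

/-- The r² terms of the numerator cancel: τ²D - (4τ² - κ)(H² + τ²r²) = κ(τ² + H²). The derivative
thus has the constant sign of κ/τ. -/
lemma hasDerivAt_angle (hκ : κ < 0) (hτ : τ ≠ 0) (hH : 0 < H) (hHκ : 0 < 4 * H ^ 2 + κ) (r : ℝ) :
    HasDerivAt (angle κ τ H) (H * κ * (τ ^ 2 + H ^ 2) /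
      ((H ^ 2 + τ ^ 2 * r ^ 2) * profileDen κ τ H r) / τ) r := by
  have hD := profileDen_pos (τ := τ) hκ hHκ r
  have hE : 0 < H ^ 2 + τ ^ 2 * r ^ 2 := by positivity
  have h1 : HasDerivAt (fun r : ℝ => τ / H * r) (τ / H) r := by
    simpa using (hasDerivAt_id r).const_mul (τ / H)
  refine (h1.arctan.sub (hasDerivAt_phase hκ hτ hHκ r)).congr_deriv ?_
  have h2 : 1 + (τ / H * r) ^ 2 = (H ^ 2 + τ ^ 2 * r ^ 2) / H ^ 2 := by field_simp
  rw [h2]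
  have h3 : (H ^ 2 + τ ^ 2 * r ^ 2) ≠ 0 := hE.ne'
  field_simp
  rw [profileDen]; ring

lemma continuous_angle : Continuous (angle κ τ H) := by
  unfold angle phase; fun_prop

lemma strictAnti_angle (hκ : κ < 0) (hτ : 0 < τ) (hH : 0 < H) (hHκ : 0 < 4 * H ^ 2 + κ) :
    StrictAnti (angle κ τ H) := by
  refine strictAnti_of_deriv_neg fun r => ?_
  rw [(hasDerivAt_angle hκ hτ.ne' hH hHκ r).deriv]
  have hD := profileDen_pos (τ := τ) hκ hHκ r
  refine div_neg_of_neg_of_pos (div_neg_of_neg_of_pos ?_ (by positivity)) hτ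
  exact mul_neg_of_neg_of_pos (mul_neg_of_pos_of_neg hH hκ) (by positivity)

lemma strictMono_angle (hκ : κ < 0) (hτ : τ < 0) (hH : 0 < H) (hHκ : 0 < 4 * H ^ 2 + κ) :
    StrictMono (angle κ τ H) := by
  refine strictMono_of_deriv_pos fun r => ?_
  rw [(hasDerivAt_angle hκ hτ.ne hH hHκ r).deriv]
  have hD := profileDen_pos (τ := τ) hκ hHκ r
  refine div_pos_of_neg_of_neg (div_neg_of_neg_of_pos ?_ (by positivity)) hτ
  exact mul_neg_of_neg_of_pos (mul_neg_of_pos_of_neg hH hκ) (by positivity)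

lemma angle_injective (hκ : κ < 0) (hτ : τ ≠ 0) (hH : 0 < H) (hHκ : 0 < 4 * H ^ 2 + κ) :
    Function.Injective (angle κ τ H) := by
  rcases lt_or_gt_of_ne hτ with h | h
  · exact (strictMono_angle hκ h hH hHκ).injective
  · exact (strictAnti_angle hκ h hH hHκ).injective

lemma abs_angle_le (hκ : κ < 0) (hτ : τ ≠ 0) (hH : 0 < H) (hHκ : 0 < 4 * H ^ 2 + κ) {r : ℝ}
    (hr : |r| ≤ 1) : |angle κ τ H r| ≤ |angle κ τ H 1| := by
  obtain ⟨h1, h2⟩ := abs_le.1 hr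
  rcases lt_or_gt_of_ne hτ with h | h
  · have hm := (strictMono_angle hκ h hH hHκ).monotone
    have h3 := hm h1
    rw [angle_neg] at h3
    exact (abs_le.2 ⟨h3, hm h2⟩).trans (le_abs_self _)
  · have hm := (strictAnti_angle hκ h hH hHκ).antitone
    have h3 := hm h1
    rw [angle_neg] at h3
    exact (abs_le.2 ⟨by linarith [hm h2], h3⟩).trans (neg_le_abs _)

/-- `H - iτr` in polar form, which turns the phase into the angle. -/
lemma zProfile_eq (hH : 0 < H) (r : ℝ) :
    zProfile κ τ H r = ((2 * √(H ^ 2 + τ ^ 2 * r ^ 2) / √(profileDen κ τ H r) : ℝ) : ℂ) *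
      Complex.exp (-(Complex.I * (angle κ τ H r : ℂ))) := by
  have hE : 0 < H ^ 2 + τ ^ 2 * r ^ 2 := by positivity
  have key : ((H : ℂ) - Complex.I * τ * r) = ((√(H ^ 2 + τ ^ 2 * r ^ 2) : ℝ) : ℂ) *
      Complex.exp (-(Complex.I * (arctan (τ / H * r) : ℂ))) := by
    have h1 : √(1 + (τ / H * r) ^ 2) = √(H ^ 2 + τ ^ 2 * r ^ 2) / H := by
      rw [show 1 + (τ / H * r) ^ 2 = (H ^ 2 + τ ^ 2 * r ^ 2) / H ^ 2 by field_simp,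
        sqrt_div hE.le, sqrt_sq hH.le]
    have h2 : -(Complex.I * (arctan (τ / H * r) : ℂ)) = ((-arctan (τ / H * r) : ℝ) : ℂ) * Complex.I := by
      push_cast; ring
    have h3 := (sqrt_pos.2 hE).ne'
    rw [h2, Complex.exp_mul_I, ← Complex.ofReal_cos, ← Complex.ofReal_sin, cos_neg, sin_neg,
      cos_arctan, sin_arctan, h1]
    have hA : √(H ^ 2 + τ ^ 2 * r ^ 2) * (1 / (√(H ^ 2 + τ ^ 2 * r ^ 2) / H)) = H := by field_simp
    have hB : √(H ^ 2 + τ ^ 2 * r ^ 2) * -(τ / H * r / (√(H ^ 2 + τ ^ 2 * r ^ 2) / H)) =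
        -(τ * r) := by field_simp
    rw [mul_add, ← mul_assoc, ← Complex.ofReal_mul, ← Complex.ofReal_mul, hA, hB]
    push_cast
    ring
  rw [zProfile, key, angle]
  have : -(Complex.I * ((arctan (τ / H * r) - phase κ τ H r : ℝ) : ℂ)) =
      -(Complex.I * (arctan (τ / H * r) : ℂ)) + Complex.I * (phase κ τ H r : ℂ) := by
    push_cast; ring
  rw [this, Complex.exp_add]
  push_cast
  ring

/-- This is the identity 4(H² + τ²r²) + κ(1 - r²) = D. -/
lemma zProfile_mem (hκ : κ < 0) (hHκ : 0 < 4 * H ^ 2 + κ) {r a b : ℝ}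
    (h : a ^ 2 + b ^ 2 + r ^ 2 = 1) :
    ‖zProfile κ τ H r‖ ^ 2 - ‖wProfile κ τ H r * (a + b * Complex.I)‖ ^ 2 = 1 := by
  have hD := profileDen_pos (τ := τ) hκ hHκ r
  have h1 : ‖Complex.exp (Complex.I * (phase κ τ H r : ℂ))‖ = 1 := by
    rw [mul_comm, Complex.norm_exp_ofReal_mul_I]
  have h2 : ‖(H - Complex.I * τ * r : ℂ)‖ ^ 2 = H ^ 2 + τ ^ 2 * r ^ 2 := by
    rw [Complex.sq_norm, Complex.normSq_apply]; simp; ring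
  have h3 : ‖(a + b * Complex.I : ℂ)‖ ^ 2 = a ^ 2 + b ^ 2 := by
    rw [Complex.sq_norm, Complex.normSq_apply]; simp; ring
  rw [zProfile, wProfile, norm_mul, norm_mul, norm_mul, h1, mul_one, mul_pow, mul_pow, h2, h3,
    Complex.norm_real, Complex.norm_real, norm_eq_abs, norm_eq_abs, sq_abs, sq_abs, div_pow,
    div_pow, sq_sqrt hD.le, sq_sqrt (by linarith : (0:ℝ) ≤ -κ)]
  field_simp
  rw [profileDen, show a ^ 2 + b ^ 2 = 1 - r ^ 2 by linarith]; ring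

lemma norm_wProfile_sq (hκ : κ < 0) (hHκ : 0 < 4 * H ^ 2 + κ) {r a b : ℝ}
    (h : a ^ 2 + b ^ 2 + r ^ 2 = 1) :
    ‖wProfile κ τ H r * (a + b * Complex.I)‖ ^ 2 = -κ * (1 - r ^ 2) / profileDen κ τ H r := by
  have hD := profileDen_pos (τ := τ) hκ hHκ r
  have h3 : ‖(a + b * Complex.I : ℂ)‖ ^ 2 = a ^ 2 + b ^ 2 := by
    rw [Complex.sq_norm, Complex.normSq_apply]; simp; ring
  rw [wProfile, norm_mul, mul_pow, h3, Complex.norm_real, norm_eq_abs, sq_abs, div_pow,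
    sq_sqrt hD.le, sq_sqrt (by linarith : (0:ℝ) ≤ -κ), show a ^ 2 + b ^ 2 = 1 - r ^ 2 by linarith]
  ring

/-! ### Derivatives of the profile functions -/

lemma hasDerivAt_inv_sqrt_profileDen (hκ : κ < 0) (hHκ : 0 < 4 * H ^ 2 + κ) (c r : ℝ) :
    HasDerivAt (fun r => c / √(profileDen κ τ H r))
      (-(c / √(profileDen κ τ H r) * ((4 * τ ^ 2 - κ) * r / profileDen κ τ H r))) r := by
  have hD := profileDen_pos (τ := τ) hκ hHκ r
  have h1 : HasDerivAt (profileDen κ τ H) ((4 * τ ^ 2 - κ) * (2 * r)) r := by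
    have := ((hasDerivAt_pow 2 r).const_mul (4 * τ ^ 2 - κ)).const_add (4 * H ^ 2 + κ)
    exact this.congr_deriv (by simp)
  have hs := (sqrt_pos.2 hD).ne'
  refine ((hasDerivAt_const r c).div (h1.sqrt hD.ne') hs).congr_deriv ?_
  rw [sq_sqrt hD.le]
  field_simp
  ring

lemma hasDerivAt_exp_phase (hκ : κ < 0) (hτ : τ ≠ 0) (hHκ : 0 < 4 * H ^ 2 + κ) (r : ℝ) :
    HasDerivAt (fun r => Complex.exp (Complex.I * (phase κ τ H r : ℂ)))
      (Complex.exp (Complex.I * (phase κ τ H r : ℂ)) *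
        (Complex.I * ((H * (4 * τ ^ 2 - κ) / (τ * profileDen κ τ H r) : ℝ) : ℂ))) r :=
  ((hasDerivAt_phase hκ hτ hHκ r).ofReal_comp.const_mul Complex.I).cexp

lemma hasDerivAt_zProfile (hκ : κ < 0) (hτ : τ ≠ 0) (hHκ : 0 < 4 * H ^ 2 + κ) (r : ℝ) :
    HasDerivAt (zProfile κ τ H)
      (((2 / √(profileDen κ τ H r) : ℝ) : ℂ) * Complex.exp (Complex.I * (phase κ τ H r : ℂ)) *
        (-(Complex.I * τ) + (H - Complex.I * τ * r) *
          (Complex.I * ((H * (4 * τ ^ 2 - κ) / (τ * profileDen κ τ H r) : ℝ) : ℂ) -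
            (((4 * τ ^ 2 - κ) * r / profileDen κ τ H r : ℝ) : ℂ)))) r := by
  have h1 := (hasDerivAt_inv_sqrt_profileDen (τ := τ) hκ hHκ 2 r).ofReal_comp
  have h2 : HasDerivAt (fun r : ℝ => (H - Complex.I * τ * r : ℂ)) (-(Complex.I * τ)) r := by
    have := ((hasDerivAt_id r).ofReal_comp.const_mul (Complex.I * (τ : ℂ))).const_sub (H : ℂ)
    simpa using this
  refine ((h1.mul h2).mul (hasDerivAt_exp_phase hκ hτ hHκ r)).congr_deriv ?_
  simp only [Pi.mul_apply]
  push_cast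
  ring

lemma hasDerivAt_wProfile (hκ : κ < 0) (hHκ : 0 < 4 * H ^ 2 + κ) (r : ℝ) :
    HasDerivAt (wProfile κ τ H) (-(wProfile κ τ H r *
      (((4 * τ ^ 2 - κ) * r / profileDen κ τ H r : ℝ) : ℂ))) r := by
  refine (hasDerivAt_inv_sqrt_profileDen (τ := τ) hκ hHκ √(-κ) r).ofReal_comp.congr_deriv ?_
  rw [wProfile]
  push_cast
  ring

lemma hasDerivAt_nuProfile (hκ : κ < 0) (hτ : τ ≠ 0) (hHκ : 0 < 4 * H ^ 2 + κ) (r : ℝ) :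
    HasDerivAt (nuProfile κ τ H) (nuProfile κ τ H r *
      (Complex.I * ((H * (4 * τ ^ 2 - κ) / (τ * profileDen κ τ H r) : ℝ) : ℂ))) r := by
  refine ((hasDerivAt_exp_phase hκ hτ hHκ r).const_mul _).congr_deriv ?_
  rw [nuProfile]
  ring

lemma contDiff_phase : ContDiff ℝ ∞ (phase κ τ H) := by
  unfold phase
  exact contDiff_const.mul (contDiff_arctan.comp (contDiff_const.mul contDiff_id))

lemma contDiff_inv_sqrt_profileDen (hκ : κ < 0) (hHκ : 0 < 4 * H ^ 2 + κ) (c : ℝ) :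
    ContDiff ℝ ∞ (fun r => c / √(profileDen κ τ H r)) := by
  have h : ContDiff ℝ ∞ (profileDen κ τ H) := by unfold profileDen; fun_prop
  exact contDiff_const.div (h.sqrt fun r => (profileDen_pos hκ hHκ r).ne')
    fun r => (sqrt_pos.2 (profileDen_pos hκ hHκ r)).ne'

lemma contDiff_exp_phase :
    ContDiff ℝ ∞ (fun r => Complex.exp (Complex.I * (phase κ τ H r : ℂ))) :=
  (contDiff_const.mul (Complex.ofRealCLM.contDiff.comp contDiff_phase)).cexp

lemma contDiff_zProfile (hκ : κ < 0) (hHκ : 0 < 4 * H ^ 2 + κ) :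
    ContDiff ℝ ∞ (zProfile κ τ H) := by
  refine ContDiff.mul (ContDiff.mul ?_ ?_) contDiff_exp_phase
  · exact Complex.ofRealCLM.contDiff.comp (contDiff_inv_sqrt_profileDen hκ hHκ 2)
  · exact contDiff_const.sub (contDiff_const.mul Complex.ofRealCLM.contDiff)

lemma contDiff_wProfile (hκ : κ < 0) (hHκ : 0 < 4 * H ^ 2 + κ) :
    ContDiff ℝ ∞ (wProfile κ τ H) :=
  Complex.ofRealCLM.contDiff.comp (contDiff_inv_sqrt_profileDen hκ hHκ √(-κ))

lemma contDiff_nuProfile : ContDiff ℝ ∞ (nuProfile κ τ H) :=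
  contDiff_const.mul contDiff_exp_phase

/-! ### The function `ρ` -/

lemma sqrt_neg_div_mem (hκ : κ < 0) (hH : 0 < H) (hHκ : 0 < 4 * H ^ 2 + κ) :
    √(-κ) / (2 * H) ∈ Set.Ioo 0 1 := by
  have h1 : 0 < √(-κ) := sqrt_pos.2 (by linarith)
  refine ⟨by positivity, ?_⟩
  rw [div_lt_one (by positivity), sqrt_lt' (by positivity)]
  nlinarith

lemma halfLength_pos (hκ : κ < 0) (hH : 0 < H) (hHκ : 0 < 4 * H ^ 2 + κ) :
    0 < halfLength κ H :=
  artanh_pos (sqrt_neg_div_mem hκ hH hHκ)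

lemma tanh_halfLength (hκ : κ < 0) (hH : 0 < H) (hHκ : 0 < 4 * H ^ 2 + κ) :
    tanh (halfLength κ H) = √(-κ) / (2 * H) := by
  have h := sqrt_neg_div_mem hκ hH hHκ
  exact tanh_artanh ⟨by linarith [h.1], h.2⟩

lemma hasDerivAt_tanh (x : ℝ) : HasDerivAt tanh (1 / cosh x ^ 2) x := by
  have h := (hasDerivAt_sinh x).div (hasDerivAt_cosh x) (cosh_pos x).ne'
  have e : (sinh / cosh : ℝ → ℝ) = tanh := by ext y; rw [tanh_eq_sinh_div_cosh]; rfl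
  rw [e] at h
  refine h.congr_deriv ?_
  rw [← cosh_sq_sub_sinh_sq x]; ring

lemma contDiff_tanh : ContDiff ℝ ∞ tanh := by
  have e : (fun x => sinh x / cosh x) = tanh := by ext y; rw [tanh_eq_sinh_div_cosh]
  rw [← e]
  exact contDiff_sinh.div contDiff_cosh fun x => (cosh_pos x).ne'

lemma strictMono_tanh : StrictMono tanh :=
  strictMono_of_deriv_pos fun x => by
    rw [(hasDerivAt_tanh x).deriv]; have := cosh_pos x; positivity

lemma rho_den_pos (hκ : κ < 0) (x : ℝ) : 0 < 1 - 4 * τ ^ 2 / κ * tanh x ^ 2 := by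
  have h : 4 * τ ^ 2 / κ ≤ 0 := div_nonpos_of_nonneg_of_nonpos (by positivity) hκ.le
  nlinarith [mul_nonneg (neg_nonneg.2 h) (sq_nonneg (tanh x))]

lemma rho_num_halfLength (hκ : κ < 0) (hH : 0 < H) (hHκ : 0 < 4 * H ^ 2 + κ) :
    1 + 4 * H ^ 2 / κ * tanh (halfLength κ H) ^ 2 = 0 := by
  rw [tanh_halfLength hκ hH hHκ, div_pow, sq_sqrt (by linarith)]
  have := hκ.ne
  field_simp
  ring

lemma rho_num_pos (hκ : κ < 0) (hH : 0 < H) (hHκ : 0 < 4 * H ^ 2 + κ) {x : ℝ}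
    (hx : x ∈ Set.Ico 0 (halfLength κ H)) : 0 < 1 + 4 * H ^ 2 / κ * tanh x ^ 2 := by
  rw [← rho_num_halfLength hκ hH hHκ]
  have h0 : 0 ≤ tanh x := by
    have := strictMono_tanh.monotone hx.1
    rwa [tanh_zero] at this
  have h1 := strictMono_tanh hx.2
  have h : 4 * H ^ 2 / κ < 0 := div_neg_of_pos_of_neg (by positivity) hκ
  have : tanh x ^ 2 < tanh (halfLength κ H) ^ 2 := by gcongr
  linarith [mul_lt_mul_of_neg_left this h]

lemma continuous_rho (hκ : κ < 0) : Continuous (rho κ τ H) := by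
  have := contDiff_tanh.continuous
  unfold rho
  exact Continuous.div (by fun_prop) (by fun_prop) fun x => (sqrt_pos.2 (rho_den_pos hκ x)).ne'

lemma rho_zero : rho κ τ H 0 = 1 := by simp [rho]

lemma rho_halfLength (hκ : κ < 0) (hH : 0 < H) (hHκ : 0 < 4 * H ^ 2 + κ) :
    rho κ τ H (halfLength κ H) = 0 := by
  rw [rho, rho_num_halfLength hκ hH hHκ, sqrt_zero, zero_div]

/-- The numerator of ρ decreases and its denominator does not. Both endpoints must be excluded: the
derivative vanishes at 0, and the square root in the numerator vanishes at a. -/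
lemma exists_hasDerivAt_rho (hκ : κ < 0) (hH : 0 < H) (hHκ : 0 < 4 * H ^ 2 + κ) {x : ℝ}
    (hx : x ∈ Set.Ioo 0 (halfLength κ H)) : ∃ c < 0, HasDerivAt (rho κ τ H) c x := by
  have hu := rho_num_pos hκ hH hHκ ⟨hx.1.le, hx.2⟩
  have hv := rho_den_pos (τ := τ) hκ x
  have h2 : HasDerivAt (fun x => tanh x ^ 2) (2 * tanh x * (1 / cosh x ^ 2)) x := by
    exact ((hasDerivAt_tanh x).pow 2).congr_deriv (by simp)
  have h3 := ((h2.const_mul (4 * H ^ 2 / κ)).const_add 1).sqrt hu.ne'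
  have h4 := ((h2.const_mul (4 * τ ^ 2 / κ)).const_sub 1).sqrt hv.ne'
  refine ⟨_, ?_, h3.div h4 (sqrt_pos.2 hv).ne'⟩
  have hc := cosh_pos x
  have ht : 0 < tanh x := by
    have := strictMono_tanh hx.1
    rwa [tanh_zero] at this
  have hT : 0 < 2 * tanh x * (1 / cosh x ^ 2) := by positivity
  have hh : 4 * H ^ 2 / κ < 0 := div_neg_of_pos_of_neg (by positivity) hκ
  have hj : 4 * τ ^ 2 / κ ≤ 0 := div_nonpos_of_nonneg_of_nonpos (by positivity) hκ.le
  have hsu := sqrt_pos.2 hu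
  have hsv := sqrt_pos.2 hv
  refine div_neg_of_neg_of_pos (sub_neg_of_lt (lt_of_lt_of_le (b := 0) ?_ ?_)) (by positivity)
  · exact mul_neg_of_neg_of_pos
      (div_neg_of_neg_of_pos (mul_neg_of_neg_of_pos hh hT) (by positivity)) hsv
  · refine mul_nonneg hsu.le (div_nonneg ?_ (by positivity))
    rw [neg_nonneg]
    exact mul_nonpos_of_nonpos_of_nonneg hj hT.le

lemma contDiffAt_rho (hκ : κ < 0) (hH : 0 < H) (hHκ : 0 < 4 * H ^ 2 + κ) {x : ℝ}
    (hx : x ∈ Set.Ioo 0 (halfLength κ H)) : ContDiffAt ℝ ∞ (rho κ τ H) x := by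
  have hu := rho_num_pos hκ hH hHκ ⟨hx.1.le, hx.2⟩
  have hv := rho_den_pos (τ := τ) hκ x
  have ht : ContDiffAt ℝ ∞ tanh x := contDiff_tanh.contDiffAt
  refine ContDiffAt.div (ContDiffAt.sqrt ?_ hu.ne') (ContDiffAt.sqrt ?_ hv.ne')
    (sqrt_pos.2 hv).ne'
  · exact contDiffAt_const.add (contDiffAt_const.mul (ht.pow 2))
  · exact contDiffAt_const.sub (contDiffAt_const.mul (ht.pow 2))

lemma strictAntiOn_rho (hκ : κ < 0) (hH : 0 < H) (hHκ : 0 < 4 * H ^ 2 + κ) :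
    StrictAntiOn (rho κ τ H) (Set.Icc 0 (halfLength κ H)) := by
  refine strictAntiOn_of_deriv_neg (convex_Icc _ _) (continuous_rho hκ).continuousOn fun x hx => ?_
  rw [interior_Icc] at hx
  obtain ⟨c, hc, h⟩ := exists_hasDerivAt_rho (τ := τ) hκ hH hHκ hx
  rwa [h.deriv]

lemma rho_mem_Ioo (hκ : κ < 0) (hH : 0 < H) (hHκ : 0 < 4 * H ^ 2 + κ) {x : ℝ}
    (hx : x ∈ Set.Ioo 0 (halfLength κ H)) : rho κ τ H x ∈ Set.Ioo 0 1 := by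
  have ha := halfLength_pos hκ hH hHκ
  have h := strictAntiOn_rho (τ := τ) hκ hH hHκ
  constructor
  · rw [← rho_halfLength (τ := τ) hκ hH hHκ]
    exact h ⟨hx.1.le, hx.2.le⟩ ⟨ha.le, le_rfl⟩ hx.2
  · rw [← rho_zero (κ := κ) (τ := τ) (H := H)]
    exact h ⟨le_rfl, ha.le⟩ ⟨hx.1.le, hx.2.le⟩ hx.1

lemma rho_mem_Ico (hκ : κ < 0) (hH : 0 < H) (hHκ : 0 < 4 * H ^ 2 + κ) {x : ℝ}
    (hx : x ∈ Set.Ioc 0 (halfLength κ H)) : rho κ τ H x ∈ Set.Ico 0 1 := by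
  rcases hx.2.lt_or_eq with h | h
  · exact Set.Ioo_subset_Ico_self (rho_mem_Ioo hκ hH hHκ ⟨hx.1, h⟩)
  · rw [h, rho_halfLength hκ hH hHκ]; exact ⟨le_rfl, one_pos⟩

lemma exists_rho_eq (hκ : κ < 0) (hH : 0 < H) (hHκ : 0 < 4 * H ^ 2 + κ) {r : ℝ}
    (hr : r ∈ Set.Ico 0 1) : ∃ x ∈ Set.Ioc 0 (halfLength κ H), rho κ τ H x = r := by
  have ha := halfLength_pos hκ hH hHκ
  have h := intermediate_value_Icc' ha.le (continuous_rho (τ := τ) (H := H) hκ).continuousOn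
  rw [rho_zero, rho_halfLength hκ hH hHκ] at h
  obtain ⟨x, hx, rfl⟩ := h (Set.Ico_subset_Icc_self hr)
  refine ⟨x, ⟨hx.1.lt_of_ne ?_, hx.2⟩, rfl⟩
  rintro rfl
  rw [rho_zero] at hr
  exact lt_irrefl _ hr.2

/-- Squaring the definition of ρ gives a linear relation between cosh² and sinh² with coefficients
in ρ²; combined with cosh² - sinh² = 1 it determines cosh². -/
lemma profileDen_mul_cosh_sq (hκ : κ < 0) (hH : 0 < H) (hHκ : 0 < 4 * H ^ 2 + κ) {x : ℝ}
    (hx : x ∈ Set.Ioc 0 (halfLength κ H)) :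
    profileDen κ τ H (rho κ τ H x) * cosh x ^ 2 = 4 * (H ^ 2 + τ ^ 2 * rho κ τ H x ^ 2) := by
  have hu : 0 ≤ 1 + 4 * H ^ 2 / κ * tanh x ^ 2 := by
    rcases hx.2.lt_or_eq with h | h
    · exact (rho_num_pos hκ hH hHκ ⟨hx.1.le, h⟩).le
    · rw [h, rho_num_halfLength hκ hH hHκ]
  have hv := rho_den_pos (τ := τ) hκ x
  have h : rho κ τ H x ^ 2 * (1 - 4 * τ ^ 2 / κ * tanh x ^ 2) = 1 + 4 * H ^ 2 / κ * tanh x ^ 2 := by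
    rw [rho, div_pow, sq_sqrt hu, sq_sqrt hv.le, div_mul_cancel₀ _ hv.ne']
  rw [tanh_eq_sinh_div_cosh] at h
  have hc := (cosh_pos x).ne'
  have hs := cosh_sq_sub_sinh_sq x
  have h' : rho κ τ H x ^ 2 * (κ * cosh x ^ 2 - 4 * τ ^ 2 * sinh x ^ 2) =
      κ * cosh x ^ 2 + 4 * H ^ 2 * sinh x ^ 2 := by
    have hk := hκ.ne
    field_simp at h
    linear_combination h
  rw [profileDen]
  linear_combination (4 * (H ^ 2 + τ ^ 2 * rho κ τ H x ^ 2)) * hs - h'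

lemma profileDen_mul_sinh_sq (hκ : κ < 0) (hH : 0 < H) (hHκ : 0 < 4 * H ^ 2 + κ) {x : ℝ}
    (hx : x ∈ Set.Ioc 0 (halfLength κ H)) :
    profileDen κ τ H (rho κ τ H x) * sinh x ^ 2 = -κ * (1 - rho κ τ H x ^ 2) := by
  have h := profileDen_mul_cosh_sq (τ := τ) hκ hH hHκ hx
  rw [cosh_sq] at h
  simp only [profileDen] at h ⊢
  linear_combination h

lemma cosh_eq (hκ : κ < 0) (hH : 0 < H) (hHκ : 0 < 4 * H ^ 2 + κ) {x : ℝ}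
    (hx : x ∈ Set.Ioc 0 (halfLength κ H)) :
    cosh x = 2 * √(H ^ 2 + τ ^ 2 * rho κ τ H x ^ 2) / √(profileDen κ τ H (rho κ τ H x)) := by
  have hD := profileDen_pos (τ := τ) hκ hHκ (rho κ τ H x)
  have hE : 0 ≤ H ^ 2 + τ ^ 2 * rho κ τ H x ^ 2 := by positivity
  refine (sq_eq_sq₀ (cosh_pos x).le (by positivity)).1 ?_
  rw [div_pow, mul_pow, sq_sqrt hE, sq_sqrt hD.le, eq_div_iff hD.ne', mul_comm,
    profileDen_mul_cosh_sq hκ hH hHκ hx]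
  ring

lemma sinh_eq (hκ : κ < 0) (hH : 0 < H) (hHκ : 0 < 4 * H ^ 2 + κ) {x : ℝ}
    (hx : x ∈ Set.Ioc 0 (halfLength κ H)) :
    sinh x = √(-κ) / √(profileDen κ τ H (rho κ τ H x)) * √(1 - rho κ τ H x ^ 2) := by
  have hD := profileDen_pos (τ := τ) hκ hHκ (rho κ τ H x)
  have hr := rho_mem_Ico (τ := τ) hκ hH hHκ hx
  refine (sq_eq_sq₀ (sinh_nonneg_iff.2 hx.1.le) (by positivity)).1 ?_
  rw [mul_pow, div_pow, sq_sqrt (by linarith : 0 ≤ -κ), sq_sqrt hD.le,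
    sq_sqrt (by nlinarith [hr.1, hr.2]), div_mul_eq_mul_div, eq_div_iff hD.ne', mul_comm,
    profileDen_mul_sinh_sq hκ hH hHκ hx]

/-! ### The latitude function -/

/-- The height of the point with parameter `x`. -/
noncomputable def height (κ τ H x : ℝ) : ℝ :=
  if x ≤ 0 then -rho κ τ H (x + halfLength κ H) else rho κ τ H (halfLength κ H - x)

lemma height_of_nonneg (hκ : κ < 0) (hH : 0 < H) (hHκ : 0 < 4 * H ^ 2 + κ) {x : ℝ} (hx : 0 ≤ x) :
    height κ τ H x = rho κ τ H (halfLength κ H - x) := by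
  rcases hx.eq_or_lt with rfl | h
  · simp [height, rho_halfLength hκ hH hHκ]
  · rw [height, if_neg (not_le.2 h)]

lemma height_of_nonpos {x : ℝ} (hx : x ≤ 0) :
    height κ τ H x = -rho κ τ H (x + halfLength κ H) := if_pos hx

lemma height_mem (hκ : κ < 0) (hH : 0 < H) (hHκ : 0 < 4 * H ^ 2 + κ) {x : ℝ}
    (hx : x ∈ Set.Ioo (-halfLength κ H) (halfLength κ H)) : height κ τ H x ∈ Set.Ioo (-1) 1 := by
  rcases le_total x 0 with h | h
  · rw [height_of_nonpos h]
    have := rho_mem_Ico (τ := τ) hκ hH hHκ (x := x + halfLength κ H)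
      ⟨by linarith [hx.1], by linarith⟩
    constructor <;> linarith [this.1, this.2]
  · rw [height_of_nonneg hκ hH hHκ h]
    have := rho_mem_Ico (τ := τ) hκ hH hHκ (x := halfLength κ H - x)
      ⟨by linarith [hx.2], by linarith⟩
    constructor <;> linarith [this.1, this.2]

lemma continuous_height (hκ : κ < 0) (hH : 0 < H) (hHκ : 0 < 4 * H ^ 2 + κ) :
    Continuous (height κ τ H) := by
  have := continuous_rho (τ := τ) (H := H) hκ
  refine Continuous.if_le (by fun_prop) (by fun_prop) continuous_id continuous_const fun x hx => ?_
  rw [show x = 0 from hx, zero_add, sub_zero, rho_halfLength hκ hH hHκ, neg_zero]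

lemma strictMonoOn_height (hκ : κ < 0) (hH : 0 < H) (hHκ : 0 < 4 * H ^ 2 + κ) :
    StrictMonoOn (height κ τ H) (Set.Ioo (-halfLength κ H) (halfLength κ H)) := by
  have ha := halfLength_pos hκ hH hHκ
  have hanti := strictAntiOn_rho (τ := τ) hκ hH hHκ
  have h1 : StrictMonoOn (height κ τ H) (Set.Ioc (-halfLength κ H) 0) := by
    intro x hx y hy hxy
    rw [height_of_nonpos hx.2, height_of_nonpos hy.2, neg_lt_neg_iff]
    exact hanti ⟨by linarith [hx.1], by linarith [hx.2]⟩ ⟨by linarith [hy.1], by linarith [hy.2]⟩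
      (by linarith)
  have h2 : StrictMonoOn (height κ τ H) (Set.Ico 0 (halfLength κ H)) := by
    intro x hx y hy hxy
    rw [height_of_nonneg hκ hH hHκ hx.1, height_of_nonneg hκ hH hHκ hy.1]
    exact hanti ⟨by linarith [hy.2], by linarith [hy.1]⟩ ⟨by linarith [hx.2], by linarith [hx.1]⟩
      (by linarith)
  rw [← Set.Ioc_union_Ico_eq_Ioo (by linarith : -halfLength κ H < 0) ha]
  exact h1.union h2 (isGreatest_Ioc (by linarith)) (isLeast_Ico ha)

lemma exists_height_eq (hκ : κ < 0) (hH : 0 < H) (hHκ : 0 < 4 * H ^ 2 + κ) {r : ℝ}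
    (hr : r ∈ Set.Ioo (-1) 1) :
    ∃ x ∈ Set.Ioo (-halfLength κ H) (halfLength κ H), height κ τ H x = r := by
  have ha := halfLength_pos hκ hH hHκ
  rcases le_total r 0 with h | h
  · obtain ⟨x, hx, e⟩ := exists_rho_eq (τ := τ) hκ hH hHκ (r := -r) ⟨by linarith, by linarith [hr.1]⟩
    refine ⟨x - halfLength κ H, ⟨by linarith [hx.1], by linarith [hx.2]⟩, ?_⟩
    rw [height_of_nonpos (by linarith [hx.2]), sub_add_cancel, e, neg_neg]
  · obtain ⟨x, hx, e⟩ := exists_rho_eq (τ := τ) hκ hH hHκ (r := r) ⟨h, hr.2⟩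
    refine ⟨halfLength κ H - x, ⟨by linarith [hx.2], by linarith [hx.1]⟩, ?_⟩
    rw [height_of_nonneg hκ hH hHκ (by linarith [hx.2]), sub_sub_cancel, e]

/-- Away from 0 the height coincides locally with one branch, whose argument stays in the open
interval where ρ is smooth. -/
lemma height_regular (hκ : κ < 0) (hH : 0 < H) (hHκ : 0 < 4 * H ^ 2 + κ) {x : ℝ}
    (hx : x ∈ Set.Ioo (-halfLength κ H) 0 ∪ Set.Ioo 0 (halfLength κ H)) :
    ContDiffAt ℝ ∞ (height κ τ H) x ∧ ∃ c > 0, HasDerivAt (height κ τ H) c x := by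
  rcases hx with hx | hx
  · have hm : x + halfLength κ H ∈ Set.Ioo 0 (halfLength κ H) :=
      ⟨by linarith [hx.1], by linarith [hx.2]⟩
    have he : height κ τ H =ᶠ[nhds x] fun x => -rho κ τ H (x + halfLength κ H) := by
      filter_upwards [Iio_mem_nhds hx.2] with y hy using height_of_nonpos (le_of_lt hy)
    obtain ⟨c, hc, h⟩ := exists_hasDerivAt_rho (τ := τ) hκ hH hHκ hm
    refine ⟨ContDiffAt.congr_of_eventuallyEq ?_ he, -c, neg_pos.2 hc,
      HasDerivAt.congr_of_eventuallyEq ?_ he⟩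
    · exact ((contDiffAt_rho hκ hH hHκ hm).comp x
        (f := fun x => x + halfLength κ H) (contDiffAt_id.add contDiffAt_const)).neg
    · exact (h.comp_add_const x _).neg
  · have hm : halfLength κ H - x ∈ Set.Ioo 0 (halfLength κ H) :=
      ⟨by linarith [hx.2], by linarith [hx.1]⟩
    have he : height κ τ H =ᶠ[nhds x] fun x => rho κ τ H (halfLength κ H - x) := by
      filter_upwards [Ioi_mem_nhds hx.1] with y hy using
        height_of_nonneg hκ hH hHκ (le_of_lt hy)
    obtain ⟨c, hc, h⟩ := exists_hasDerivAt_rho (τ := τ) hκ hH hHκ hm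
    refine ⟨ContDiffAt.congr_of_eventuallyEq ?_ he, -c, neg_pos.2 hc,
      HasDerivAt.congr_of_eventuallyEq ?_ he⟩
    · exact (contDiffAt_rho hκ hH hHκ hm).comp x
        (f := fun x => halfLength κ H - x) (contDiffAt_const.sub contDiffAt_id)
    · exact h.comp_const_sub _ x

lemma isLatitude_arcsin_height (hκ : κ < 0) (hH : 0 < H) (hHκ : 0 < 4 * H ^ 2 + κ) :
    IsLatitude (halfLength κ H) (fun x => arcsin (height κ τ H x)) := by
  have ha := halfLength_pos hκ hH hHκ
  have hsub : ∀ x ∈ Set.Ioo (-halfLength κ H) 0 ∪ Set.Ioo 0 (halfLength κ H),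
      x ∈ Set.Ioo (-halfLength κ H) (halfLength κ H) := by
    rintro x (h | h)
    · exact ⟨h.1, by linarith [h.2]⟩
    · exact ⟨by linarith [h.1], h.2⟩
  refine ⟨(continuous_arcsin.comp (continuous_height hκ hH hHκ)).continuousOn, ?_, ?_, ?_, ?_⟩
  · intro x hx y hy hxy
    have h1 := height_mem (τ := τ) hκ hH hHκ hx
    have h2 := height_mem (τ := τ) hκ hH hHκ hy
    exact strictMonoOn_arcsin ⟨h1.1.le, h1.2.le⟩ ⟨h2.1.le, h2.2.le⟩
      (strictMonoOn_height hκ hH hHκ hx hy hxy)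
  · ext y
    constructor
    · rintro ⟨x, hx, rfl⟩
      have h := height_mem (τ := τ) hκ hH hHκ hx
      exact ⟨neg_pi_div_two_lt_arcsin.2 h.1, arcsin_lt_pi_div_two.2 h.2⟩
    · intro hy
      have h1 : sin y ∈ Set.Ioo (-1) 1 := by
        have hp := pi_pos
        rw [← sin_pi_div_two, ← sin_neg]
        exact ⟨strictMonoOn_sin ⟨le_rfl, by linarith⟩ ⟨hy.1.le, hy.2.le⟩ hy.1,
          strictMonoOn_sin ⟨hy.1.le, hy.2.le⟩ ⟨by linarith, le_rfl⟩ hy.2⟩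
      obtain ⟨x, hx, e⟩ := exists_height_eq (τ := τ) hκ hH hHκ h1
      exact ⟨x, hx, by simp only [e]; exact arcsin_sin hy.1.le hy.2.le⟩
  · intro x hx
    have h := height_mem (τ := τ) hκ hH hHκ (hsub x hx)
    exact ((contDiffAt_arcsin h.1.ne' h.2.ne).comp x
      (height_regular hκ hH hHκ hx).1).contDiffWithinAt
  · intro x hx
    have h := height_mem (τ := τ) hκ hH hHκ (hsub x hx)
    obtain ⟨c, hc, hd⟩ := (height_regular (τ := τ) hκ hH hHκ hx).2
    have := (hasDerivAt_arcsin h.1.ne' h.2.ne).comp x hd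
    rw [show (fun x => arcsin (height κ τ H x)) = arcsin ∘ height κ τ H from rfl, this.deriv]
    have h3 : 0 < 1 - height κ τ H x ^ 2 := by nlinarith [h.1, h.2]
    exact mul_pos (one_div_pos.2 (sqrt_pos.2 h3)) hc

/-! ### Coordinates in the frame -/

/-- The horizontal coordinates are the real and imaginary parts of the single complex number z dw -
w dz, so rotating the horizontal frame becomes complex multiplication. -/
lemma frameCoord_eq (p X : ℂ × ℂ) : frameCoord p X =
    ![(p.1 * X.2 - p.2 * X.1).re, (p.1 * X.2 - p.2 * X.1).im,
      (X.1 * starRingEnd ℂ p.1 - X.2 * starRingEnd ℂ p.2).im] := by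
  funext i
  fin_cases i <;> simp [frameCoord, neutral, frame] <;> ring

lemma frameCoord_sum {p : ℂ × ℂ} (hp : p ∈ carrier) (c : Fin 3 → ℝ) :
    frameCoord p (∑ k, c k • frame k p) = c := by
  have hlin : ∀ i, frameCoord p (∑ k, c k • frame k p) i =
      ∑ k, c k * frameCoord p (frame k p) i := by
    intro i
    fin_cases i <;> simp [Fin.sum_univ_three, frameCoord, neutral] <;> ring
  funext i
  rw [hlin]
  simp [frameCoord_frame hp]

lemma isTangent_sum (p : ℂ × ℂ) (c : Fin 3 → ℝ) : IsTangent p (∑ k, c k • frame k p) := by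
  have h : neutral p (∑ k, c k • frame k p) = ∑ k, c k * neutral p (frame k p) := by
    simp [Fin.sum_univ_three, neutral]; ring
  rw [IsTangent, h]
  exact Finset.sum_eq_zero fun k _ => by rw [show neutral p (frame k p) = 0 from
    frame_isTangent p k, mul_zero]

/-- The coordinates, in the frame, of a vector with coordinates `x, y` in the orthonormal frame
which is obtained by normalising `frame` and rotating its horizontal part by `Ω`. -/
noncomputable def rotCoord (κ τ : ℝ) (Ω x : ℂ) (y : ℝ) : Fin 3 → ℝ :=
  ![((√(-κ) / 2 : ℝ) * (Ω * x)).re, ((√(-κ) / 2 : ℝ) * (Ω * x)).im, -κ / (4 * τ) * y]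

/-- The factors √(-κ)/2 and -κ/(4τ) have squares inverse to `frameNormSq`, and a rotation preserves
the Euclidean product. -/
lemma metric_of_rotCoord (hκ : κ < 0) (hτ : τ ≠ 0) {p X X' : ℂ × ℂ} {Ω x x' : ℂ} {y y' : ℝ}
    (hΩ : ‖Ω‖ = 1) (h : frameCoord p X = rotCoord κ τ Ω x y)
    (h' : frameCoord p X' = rotCoord κ τ Ω x' y') :
    metric κ τ p X X' = x.re * x'.re + x.im * x'.im + y * y' := by
  have hΩ2 : Ω.re * Ω.re + Ω.im * Ω.im = 1 := by
    rw [← Complex.normSq_apply, ← Complex.sq_norm, hΩ, one_pow]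
  have hk : √(-κ) ^ 2 = -κ := sq_sqrt (by linarith)
  rw [metric, h, h']
  have e1 : 4 / -κ * (√(-κ) / 2) ^ 2 = 1 := by
    rw [div_pow, hk]; have := hκ.ne; field_simp; norm_num
  have e2 : 16 * τ ^ 2 / κ ^ 2 * (-κ / (4 * τ)) ^ 2 = 1 := by
    have := hκ.ne; field_simp; norm_num
  simp only [Fin.sum_univ_three, frameNormSq, rotCoord, Matrix.cons_val_zero, Matrix.cons_val_one,
    Matrix.cons_val_two, Matrix.head_cons, Matrix.tail_cons, Complex.mul_re, Complex.mul_im,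
    Complex.ofReal_re, Complex.ofReal_im]
  linear_combination (Ω.re * Ω.re + Ω.im * Ω.im) * (x.re * x'.re + x.im * x'.im) * e1 +
    y * y' * e2 + (x.re * x'.re + x.im * x'.im) * hΩ2

/-! ### The sphere -/

/-- The map of `ℝ³` whose restriction to the unit sphere is the immersion. -/
noncomputable def ambientMap (κ τ H : ℝ) (x : EuclideanSpace ℝ (Fin 3)) : ℂ × ℂ :=
  (zProfile κ τ H (x 2), wProfile κ τ H (x 2) * (x 0 + x 1 * Complex.I))

/-- The horizontal part of the normal field. -/
noncomputable def ambientNu (κ τ H : ℝ) (x : EuclideanSpace ℝ (Fin 3)) : ℂ :=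
  nuProfile κ τ H (x 2) * (x 0 + x 1 * Complex.I)

/-- The immersed sphere. -/
noncomputable def sphereMap (κ τ H : ℝ) (p : Sphere) : ℂ × ℂ := ambientMap κ τ H p

/-- The coordinates of its unit normal field. -/
noncomputable def normalCoord (κ τ H : ℝ) (p : Sphere) : Fin 3 → ℝ :=
  ![(ambientNu κ τ H p).re, (ambientNu κ τ H p).im, κ / (4 * τ) * (p : EuclideanSpace ℝ (Fin 3)) 2]

/-- The unit normal field of the immersed sphere. -/
noncomputable def sphereNormal (κ τ H : ℝ) (p : Sphere) : ℂ × ℂ :=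
  ∑ k, normalCoord κ τ H p k • frame k (sphereMap κ τ H p)

/-- The differential of the inclusion of the sphere. -/
noncomputable def inclDeriv (p : Sphere) (u : TangentSpace (𝓡 2) p) : EuclideanSpace ℝ (Fin 3) :=
  mfderiv (𝓡 2) 𝓘(ℝ, EuclideanSpace ℝ (Fin 3))
    ((↑) : Sphere → EuclideanSpace ℝ (Fin 3)) p u

lemma finrank_euclidean_three : Fact (Module.finrank ℝ (EuclideanSpace ℝ (Fin 3)) = 2 + 1) :=
  ⟨finrank_euclideanSpace_fin⟩

lemma contMDiff_incl : ContMDiff (𝓡 2) 𝓘(ℝ, EuclideanSpace ℝ (Fin 3)) ∞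
    ((↑) : Sphere → EuclideanSpace ℝ (Fin 3)) :=
  @contMDiff_coe_sphere _ _ _ ∞ 2 finrank_euclidean_three

lemma inclDeriv_injective (p : Sphere) : Function.Injective (inclDeriv p) :=
  @injective_mvfderiv_subtypeVal_sphere _ _ _ 2 finrank_euclidean_three p

lemma sphere_sq_sum (p : Sphere) : (p : EuclideanSpace ℝ (Fin 3)) 0 ^ 2 +
    (p : EuclideanSpace ℝ (Fin 3)) 1 ^ 2 + (p : EuclideanSpace ℝ (Fin 3)) 2 ^ 2 = 1 := by
  have h := p.2
  rw [mem_sphere_zero_iff_norm, EuclideanSpace.norm_eq, sqrt_eq_one] at h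
  simpa [Fin.sum_univ_three] using h

lemma inclDeriv_orthogonal (p : Sphere) (u : TangentSpace (𝓡 2) p) :
    (p : EuclideanSpace ℝ (Fin 3)) 0 * inclDeriv p u 0 +
    (p : EuclideanSpace ℝ (Fin 3)) 1 * inclDeriv p u 1 +
    (p : EuclideanSpace ℝ (Fin 3)) 2 * inclDeriv p u 2 = 0 := by
  have h : inclDeriv p u ∈ (Submodule.span ℝ {(p : EuclideanSpace ℝ (Fin 3))})ᗮ := by
    rw [← @range_mvfderiv_subtypeVal _ _ _ 2 finrank_euclidean_three p]
    exact ⟨u, rfl⟩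
  rw [Submodule.mem_orthogonal_singleton_iff_inner_right] at h
  simp [PiLp.inner_apply, Fin.sum_univ_three] at h
  linarith

/-- Every derivative on the sphere below reduces through this chain rule to a Fréchet derivative in
ℝ³; no charts are needed. -/
lemma mfderiv_comp_incl {G : Type*} [NormedAddCommGroup G] [NormedSpace ℝ G]
    {f : EuclideanSpace ℝ (Fin 3) → G} {f' : EuclideanSpace ℝ (Fin 3) →L[ℝ] G} (p : Sphere)
    (hf : HasFDerivAt f f' p) (u : TangentSpace (𝓡 2) p) :
    (mfderiv (𝓡 2) 𝓘(ℝ, G) (fun q : Sphere => f q) p u : G) = f' (inclDeriv p u) := by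
  have h1 : MDifferentiableAt (𝓡 2) 𝓘(ℝ, EuclideanSpace ℝ (Fin 3))
      ((↑) : Sphere → EuclideanSpace ℝ (Fin 3)) p :=
    (contMDiff_incl p).mdifferentiableAt (by simp)
  have h2 := hf.hasMFDerivAt.comp p h1.hasMFDerivAt
  have h3 := h2.mfderiv
  exact congrArg (fun T : TangentSpace (𝓡 2) p →L[ℝ] G => T u) h3

lemma exists_hasFDerivAt_height {A : ℝ → ℂ} {A' : ℂ} {x : EuclideanSpace ℝ (Fin 3)}
    (h : HasDerivAt A A' (x 2)) : ∃ T : EuclideanSpace ℝ (Fin 3) →L[ℝ] ℂ,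
      HasFDerivAt (fun x : EuclideanSpace ℝ (Fin 3) => A (x 2)) T x ∧ ∀ U, T U = A' * U 2 := by
  have h1 : HasFDerivAt (fun x : EuclideanSpace ℝ (Fin 3) => x 2)
      (EuclideanSpace.proj 2 : EuclideanSpace ℝ (Fin 3) →L[ℝ] ℝ) x :=
    (EuclideanSpace.proj 2 : EuclideanSpace ℝ (Fin 3) →L[ℝ] ℝ).hasFDerivAt
  refine ⟨_, h.hasFDerivAt.comp x h1, fun U => ?_⟩
  simp [mul_comm]

lemma exists_hasFDerivAt_axial {A : ℝ → ℂ} {A' : ℂ} {x : EuclideanSpace ℝ (Fin 3)}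
    (h : HasDerivAt A A' (x 2)) : ∃ T : EuclideanSpace ℝ (Fin 3) →L[ℝ] ℂ,
      HasFDerivAt (fun x : EuclideanSpace ℝ (Fin 3) => A (x 2) * (x 0 + x 1 * Complex.I)) T x ∧
        ∀ U, T U = A' * U 2 * (x 0 + x 1 * Complex.I) + A (x 2) * (U 0 + U 1 * Complex.I) := by
  obtain ⟨T, hT, hT'⟩ := exists_hasFDerivAt_height h
  have h0 : HasFDerivAt (fun x : EuclideanSpace ℝ (Fin 3) => ((x 0 : ℝ) : ℂ))
      (Complex.ofRealCLM.comp (EuclideanSpace.proj 0 : EuclideanSpace ℝ (Fin 3) →L[ℝ] ℝ)) x :=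
    (Complex.ofRealCLM.comp
      (EuclideanSpace.proj 0 : EuclideanSpace ℝ (Fin 3) →L[ℝ] ℝ)).hasFDerivAt
  have h1 : HasFDerivAt (fun x : EuclideanSpace ℝ (Fin 3) => ((x 1 : ℝ) : ℂ))
      (Complex.ofRealCLM.comp (EuclideanSpace.proj 1 : EuclideanSpace ℝ (Fin 3) →L[ℝ] ℝ)) x :=
    (Complex.ofRealCLM.comp
      (EuclideanSpace.proj 1 : EuclideanSpace ℝ (Fin 3) →L[ℝ] ℝ)).hasFDerivAt
  refine ⟨_, hT.mul (h0.add (h1.mul_const Complex.I)), fun U => ?_⟩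
  simp [hT']
  ring

lemma contDiff_ambientMap (hκ : κ < 0) (hHκ : 0 < 4 * H ^ 2 + κ) :
    ContDiff ℝ ∞ (ambientMap κ τ H) := by
  have h : ∀ i : Fin 3, ContDiff ℝ ∞ (fun x : EuclideanSpace ℝ (Fin 3) => x i) := fun i =>
    (EuclideanSpace.proj i : EuclideanSpace ℝ (Fin 3) →L[ℝ] ℝ).contDiff
  have hc : ∀ i : Fin 3, ContDiff ℝ ∞ (fun x : EuclideanSpace ℝ (Fin 3) => ((x i : ℝ) : ℂ)) :=
    fun i => Complex.ofRealCLM.contDiff.comp (h i)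
  exact ((contDiff_zProfile hκ hHκ).comp (h 2)).prodMk
    (((contDiff_wProfile hκ hHκ).comp (h 2)).mul ((hc 0).add ((hc 1).mul contDiff_const)))

lemma contDiff_ambientNu : ContDiff ℝ ∞ (ambientNu κ τ H) := by
  have h : ∀ i : Fin 3, ContDiff ℝ ∞ (fun x : EuclideanSpace ℝ (Fin 3) => x i) := fun i =>
    (EuclideanSpace.proj i : EuclideanSpace ℝ (Fin 3) →L[ℝ] ℝ).contDiff
  have hc : ∀ i : Fin 3, ContDiff ℝ ∞ (fun x : EuclideanSpace ℝ (Fin 3) => ((x i : ℝ) : ℂ)) :=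
    fun i => Complex.ofRealCLM.contDiff.comp (h i)
  exact (contDiff_nuProfile.comp (h 2)).mul ((hc 0).add ((hc 1).mul contDiff_const))

lemma contMDiff_sphereMap (hκ : κ < 0) (hHκ : 0 < 4 * H ^ 2 + κ) :
    ContMDiff (𝓡 2) 𝓘(ℝ, ℂ × ℂ) ∞ (sphereMap κ τ H) :=
  (contDiff_ambientMap hκ hHκ).contMDiff.comp contMDiff_incl

lemma contDiff_frame (i : Fin 3) : ContDiff ℝ ∞ (frame i) := by
  have h1 : ContDiff ℝ ∞ (fun p : ℂ × ℂ => starRingEnd ℂ p.1) :=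
    Complex.conjCLE.contDiff.comp contDiff_fst
  have h2 : ContDiff ℝ ∞ (fun p : ℂ × ℂ => starRingEnd ℂ p.2) :=
    Complex.conjCLE.contDiff.comp contDiff_snd
  fin_cases i
  · exact h2.prodMk h1
  · exact (contDiff_const.mul h2).prodMk (contDiff_const.mul h1)
  · exact (contDiff_const.mul contDiff_fst).prodMk (contDiff_const.mul contDiff_snd)

lemma contMDiff_sphereNormal (hκ : κ < 0) (hHκ : 0 < 4 * H ^ 2 + κ) :
    ContMDiff (𝓡 2) 𝓘(ℝ, ℂ × ℂ) ∞ (sphereNormal κ τ H) := by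
  have hF : ∀ k, ContDiff ℝ ∞ (fun x => frame k (ambientMap κ τ H x)) := fun k =>
    (contDiff_frame k).comp (contDiff_ambientMap hκ hHκ)
  have h0 : ContDiff ℝ ∞ (fun x => (ambientNu κ τ H x).re) :=
    Complex.reCLM.contDiff.comp contDiff_ambientNu
  have h1 : ContDiff ℝ ∞ (fun x => (ambientNu κ τ H x).im) :=
    Complex.imCLM.contDiff.comp contDiff_ambientNu
  have h2 : ContDiff ℝ ∞ (fun x : EuclideanSpace ℝ (Fin 3) => κ / (4 * τ) * x 2) :=
    contDiff_const.mul (EuclideanSpace.proj 2 : EuclideanSpace ℝ (Fin 3) →L[ℝ] ℝ).contDiff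
  have h := ((h0.smul (hF 0)).add (h1.smul (hF 1))).add (h2.smul (hF 2))
  have e : sphereNormal κ τ H = (fun x => (ambientNu κ τ H x).re • frame 0 (ambientMap κ τ H x) +
      (ambientNu κ τ H x).im • frame 1 (ambientMap κ τ H x) +
      (κ / (4 * τ) * x 2) • frame 2 (ambientMap κ τ H x)) ∘
        ((↑) : Sphere → EuclideanSpace ℝ (Fin 3)) := by
    funext p
    simp [sphereNormal, normalCoord, Fin.sum_univ_three, sphereMap]
  rw [e]
  exact h.contMDiff.comp contMDiff_incl

lemma sphereMap_mem (hκ : κ < 0) (hHκ : 0 < 4 * H ^ 2 + κ) (p : Sphere) :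
    sphereMap κ τ H p ∈ carrier :=
  zProfile_mem hκ hHκ (sphere_sq_sum p)

lemma frameCoord_sphereNormal (hκ : κ < 0) (hHκ : 0 < 4 * H ^ 2 + κ) (p : Sphere) :
    frameCoord (sphereMap κ τ H p) (sphereNormal κ τ H p) = normalCoord κ τ H p :=
  frameCoord_sum (sphereMap_mem hκ hHκ p) _

/-! ### Derivatives along the sphere -/

lemma differential_sphereMap (hκ : κ < 0) (hτ : τ ≠ 0) (hHκ : 0 < 4 * H ^ 2 + κ) (p : Sphere)
    (u : TangentSpace (𝓡 2) p) :
    differential (sphereMap κ τ H) p u =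
      (deriv (zProfile κ τ H) (p.1 2) * inclDeriv p u 2,
       deriv (wProfile κ τ H) (p.1 2) * inclDeriv p u 2 * (p.1 0 + p.1 1 * Complex.I) +
        wProfile κ τ H (p.1 2) * (inclDeriv p u 0 + inclDeriv p u 1 * Complex.I)) := by
  obtain ⟨T, hT, hT'⟩ := exists_hasFDerivAt_height (x := p.1)
    (hasDerivAt_zProfile hκ hτ hHκ (p.1 2)).differentiableAt.hasDerivAt
  obtain ⟨S, hS, hS'⟩ := exists_hasFDerivAt_axial (x := p.1)
    (hasDerivAt_wProfile (τ := τ) hκ hHκ (p.1 2)).differentiableAt.hasDerivAt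
  rw [← hT', ← hS']
  exact mfderiv_comp_incl p (hT.prodMk hS) u

lemma dirDeriv_normalCoord (hκ : κ < 0) (hτ : τ ≠ 0) (hHκ : 0 < 4 * H ^ 2 + κ) (p : Sphere)
    (u : TangentSpace (𝓡 2) p) :
    (fun k => dirDeriv (fun q => normalCoord κ τ H q k) p u) =
      ![(deriv (nuProfile κ τ H) (p.1 2) * inclDeriv p u 2 * (p.1 0 + p.1 1 * Complex.I) +
        nuProfile κ τ H (p.1 2) * (inclDeriv p u 0 + inclDeriv p u 1 * Complex.I)).re,
        (deriv (nuProfile κ τ H) (p.1 2) * inclDeriv p u 2 * (p.1 0 + p.1 1 * Complex.I) +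
        nuProfile κ τ H (p.1 2) * (inclDeriv p u 0 + inclDeriv p u 1 * Complex.I)).im,
        κ / (4 * τ) * inclDeriv p u 2] := by
  obtain ⟨S, hS, hS'⟩ := exists_hasFDerivAt_axial (x := p.1)
    (hasDerivAt_nuProfile hκ hτ hHκ (p.1 2)).differentiableAt.hasDerivAt
  have h2 := ((EuclideanSpace.proj 2 : EuclideanSpace ℝ (Fin 3) →L[ℝ] ℝ).hasFDerivAt
    (x := p.1)).const_mul (κ / (4 * τ))
  rw [← hS']
  funext k
  fin_cases k
  · exact mfderiv_comp_incl p (Complex.reCLM.hasFDerivAt.comp _ hS) u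
  · exact mfderiv_comp_incl p (Complex.imCLM.hasFDerivAt.comp _ hS) u
  · exact mfderiv_comp_incl p h2 u

/-! ### Polar coordinates -/

/-- `ξ` and `s` are polar coordinates of the horizontal part of `x`. -/
structure IsPolar (x : EuclideanSpace ℝ (Fin 3)) (ξ : ℂ) (s : ℝ) : Prop where
  norm_eq : ‖ξ‖ = 1
  sq_add_sq : s ^ 2 + x 2 ^ 2 = 1
  eq_mul : (x 0 + x 1 * Complex.I : ℂ) = s * ξ

lemma exists_isPolar (p : Sphere) : ∃ ξ s, IsPolar p.1 ξ s := by
  have h := sphere_sq_sum p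
  have hn : ‖(p.1 0 + p.1 1 * Complex.I : ℂ)‖ ^ 2 = p.1 0 ^ 2 + p.1 1 ^ 2 := by
    rw [Complex.sq_norm, Complex.normSq_apply]; simp; ring
  by_cases h0 : (p.1 0 + p.1 1 * Complex.I : ℂ) = 0
  -- At a pole s = 0 and any unit ξ serves, so the computations in polar coordinates also cover the
  -- poles.
  · refine ⟨1, 0, by simp, ?_, by simp [h0]⟩
    rw [h0] at hn
    simp at hn
    linarith
  · refine ⟨(p.1 0 + p.1 1 * Complex.I : ℂ) / ‖(p.1 0 + p.1 1 * Complex.I : ℂ)‖,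
      ‖(p.1 0 + p.1 1 * Complex.I : ℂ)‖, ?_, by rw [hn]; exact h, ?_⟩
    · rw [norm_div, Complex.norm_real, norm_norm, div_self (norm_ne_zero_iff.2 h0)]
    · rw [mul_div_cancel₀]
      exact Complex.ofReal_ne_zero.2 (norm_ne_zero_iff.2 h0)

/-- Coordinates of a vector tangent to the sphere along the meridian and the parallel. -/
lemma IsPolar.exists_tangent {x U : EuclideanSpace ℝ (Fin 3)} {ξ : ℂ} {s : ℝ} (h : IsPolar x ξ s)
    (hU : x 0 * U 0 + x 1 * U 1 + x 2 * U 2 = 0) : ∃ m l : ℝ,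
      (U 0 + U 1 * Complex.I : ℂ) = ξ * (-(x 2 * m : ℝ) + l * Complex.I) ∧ U 2 = s * m := by
  have hξ : ξ.re * ξ.re + ξ.im * ξ.im = 1 := by
    rw [← Complex.normSq_apply, ← Complex.sq_norm, h.norm_eq, one_pow]
  have h0 : x 0 = s * ξ.re := by simpa using congrArg Complex.re h.eq_mul
  have h1 : x 1 = s * ξ.im := by simpa using congrArg Complex.im h.eq_mul
  rw [h0, h1] at hU
  have hs := h.sq_add_sq
  set a := ξ.re * U 0 + ξ.im * U 1 with ha
  have e1 : s * a + x 2 * U 2 = 0 := by rw [ha]; linear_combination hU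
  have e2 : x 2 * (-(x 2 * a) + s * U 2) = -a := by linear_combination s * e1 - a * hs
  -- The components are the inner products of U with the unit vectors (-x₂ξ, s) along the meridian
  -- and (iξ, 0) along the parallel.
  refine ⟨-(x 2 * a) + s * U 2, ξ.re * U 1 - ξ.im * U 0, ?_, ?_⟩
  · rw [e2, ha]
    apply Complex.ext <;> simp
    · linear_combination -U 0 * hξ
    · linear_combination -U 1 * hξ
  · linear_combination x 2 * e1 - U 2 * hs

/-! ### The first and second fundamental forms in polar coordinates -/

/-- Component along the meridian of the differential, in the normalised frame. -/
noncomputable def meridianPart (κ τ H r m l : ℝ) : ℝ :=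
  4 / profileDen κ τ H r * (4 * H * (H ^ 2 + τ ^ 2) / profileDen κ τ H r * m - τ * l)

/-- Component along the parallel of the differential, in the normalised frame. -/
noncomputable def parallelPart (κ τ H r m l : ℝ) : ℝ :=
  4 / profileDen κ τ H r * (H * l + (H ^ 2 + τ ^ 2) * (profileDen κ τ H r - 4 * H ^ 2) /
    (τ * profileDen κ τ H r) * m)

/-- The rotation of the normalised frame. -/
noncomputable def rotation (κ τ H r : ℝ) (ξ : ℂ) : ℂ :=
  ξ * Complex.exp (Complex.I * (phase κ τ H r : ℂ))

lemma norm_exp_phase (r : ℝ) : ‖Complex.exp (Complex.I * (phase κ τ H r : ℂ))‖ = 1 := by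
  rw [mul_comm, Complex.norm_exp_ofReal_mul_I]

lemma norm_rotation (r : ℝ) {ξ : ℂ} (h : ‖ξ‖ = 1) : ‖rotation κ τ H r ξ‖ = 1 := by
  rw [rotation, norm_mul, h, norm_exp_phase, one_mul]

lemma mul_conj_eq_one {z : ℂ} (h : ‖z‖ = 1) : z * starRingEnd ℂ z = 1 := by
  rw [Complex.mul_conj, ← Complex.sq_norm, h]; simp

/-- Used to trade s² for D; here 4(H² + τ²) is the value of D at r = ±1. -/
lemma profileDen_add {r s : ℝ} (h : s ^ 2 + r ^ 2 = 1) :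
    s ^ 2 * (4 * τ ^ 2 - κ) = 4 * (H ^ 2 + τ ^ 2) - profileDen κ τ H r := by
  rw [profileDen]; linear_combination (4 * τ ^ 2 - κ) * h

lemma horizontal_differential (hκ : κ < 0) (hτ : τ ≠ 0) (hHκ : 0 < 4 * H ^ 2 + κ) {r s m l : ℝ}
    (h : s ^ 2 + r ^ 2 = 1) (ξ : ℂ) :
    zProfile κ τ H r * (deriv (wProfile κ τ H) r * (s * m : ℝ) * (s * ξ) +
        wProfile κ τ H r * (ξ * (-(r * m : ℝ) + l * Complex.I))) -
      wProfile κ τ H r * (s * ξ) * (deriv (zProfile κ τ H) r * (s * m : ℝ)) =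
    (√(-κ) / 2 : ℝ) * (rotation κ τ H r ξ * (((-(r * meridianPart κ τ H r m l) : ℝ) : ℂ) +
      (parallelPart κ τ H r m l : ℝ) * Complex.I)) := by
  rw [(hasDerivAt_zProfile hκ hτ hHκ r).deriv, (hasDerivAt_wProfile hκ hHκ r).deriv]
  have hD := profileDen_pos (τ := τ) hκ hHκ r
  have hg := profileDen_add (κ := κ) (τ := τ) (H := H) h
  simp only [zProfile, wProfile, rotation, meridianPart, parallelPart]
  set D := profileDen κ τ H r
  set q := √D with hq
  set e := Complex.exp (Complex.I * (phase κ τ H r : ℂ))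
  have hq2 : q ^ 2 = D := sq_sqrt hD.le
  have hq0 : q ≠ 0 := (sqrt_pos.2 hD).ne'
  set k := √(-κ)
  -- A and C stand for the moduli 2/√D and √(-κ)/√D, θ' for the derivative of the phase and -g' for
  -- the logarithmic derivative of 1/√D. The latter is common to both profiles and cancels in the
  -- antisymmetric expression z dw - w dz.
  have key : ∀ A C θ' g' : ℝ,
      (A : ℂ) * (H - Complex.I * τ * r) * e * (-((C : ℂ) * (g' : ℂ)) * (s * m : ℝ) * (s * ξ) +
        (C : ℂ) * (ξ * (-(r * m : ℝ) + l * Complex.I))) - (C : ℂ) * (s * ξ) *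
        ((A : ℂ) * e * (-(Complex.I * τ) + (H - Complex.I * τ * r) *
          (Complex.I * (θ' : ℂ) - (g' : ℂ))) * (s * m : ℝ)) =
      ξ * e * (((A * C * (-(H * r * m) + τ * r * l - s ^ 2 * m * τ * r * θ') : ℝ) : ℂ) +
        ((A * C * (H * l + τ * r ^ 2 * m + s ^ 2 * m * (τ - H * θ')) : ℝ) : ℂ) * Complex.I) := by
    intro A C θ' g'
    push_cast
    linear_combination (ξ * e * A * C * (-(τ * r * l) + s ^ 2 * m * τ * r * θ')) * Complex.I_sq
  rw [key]
  have hAC : 2 / q * (k / q) = 2 * k / D := by rw [← hq2]; field_simp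
  have e1 : 2 / q * (k / q) * (-(H * r * m) + τ * r * l - s ^ 2 * m * τ * r *
      (H * (4 * τ ^ 2 - κ) / (τ * D))) =
      k / 2 * -(r * (4 / D * (4 * H * (H ^ 2 + τ ^ 2) / D * m - τ * l))) := by
    rw [hAC]
    field_simp
    linear_combination -(4 * k * r * H * m) * hg
  have e2 : 2 / q * (k / q) * (H * l + τ * r ^ 2 * m + s ^ 2 * m * (τ - H *
      (H * (4 * τ ^ 2 - κ) / (τ * D)))) =
      k / 2 * (4 / D * (H * l + (H ^ 2 + τ ^ 2) * (D - 4 * H ^ 2) / (τ * D) * m)) := by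
    rw [hAC]
    field_simp
    linear_combination 4 * k * τ ^ 2 * D * m * h - 4 * k * H ^ 2 * m * hg
  rw [e1, e2]
  push_cast
  ring

lemma vertical_differential (hκ : κ < 0) (hτ : τ ≠ 0) (hHκ : 0 < 4 * H ^ 2 + κ) (r s m l : ℝ)
    {ξ : ℂ} (hξ : ‖ξ‖ = 1) :
    (deriv (zProfile κ τ H) r * (s * m : ℝ) * starRingEnd ℂ (zProfile κ τ H r) -
      (deriv (wProfile κ τ H) r * (s * m : ℝ) * (s * ξ) +
        wProfile κ τ H r * (ξ * (-(r * m : ℝ) + l * Complex.I))) *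
      starRingEnd ℂ (wProfile κ τ H r * (s * ξ))).im =
    -κ / (4 * τ) * (s * meridianPart κ τ H r m l) := by
  rw [(hasDerivAt_zProfile hκ hτ hHκ r).deriv, (hasDerivAt_wProfile hκ hHκ r).deriv]
  have hD := profileDen_pos (τ := τ) hκ hHκ r
  have he := mul_conj_eq_one (norm_exp_phase (κ := κ) (τ := τ) (H := H) r)
  have hξ' := mul_conj_eq_one hξ
  have hDr : profileDen κ τ H r = (4 * H ^ 2 + κ) + (4 * τ ^ 2 - κ) * r ^ 2 := rfl
  have hk : √(-κ) ^ 2 = -κ := sq_sqrt (by linarith)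
  simp only [zProfile, wProfile, meridianPart]
  set D := profileDen κ τ H r
  set q := √D with hq
  set e := Complex.exp (Complex.I * (phase κ τ H r : ℂ))
  set k := √(-κ)
  have hq2 : q ^ 2 = D := sq_sqrt hD.le
  have hq0 : q ≠ 0 := (sqrt_pos.2 hD).ne'
  -- The unit factors e^{iθ} and ξ cancel against their conjugates, and the terms in g' are real,
  -- hence absent from the imaginary part.
  have key : ∀ A C θ' g' : ℝ,
      ((A : ℂ) * e * (-(Complex.I * τ) + (H - Complex.I * τ * r) *
        (Complex.I * (θ' : ℂ) - (g' : ℂ))) * (s * m : ℝ) *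
          starRingEnd ℂ ((A : ℂ) * (H - Complex.I * τ * r) * e) -
        (-((C : ℂ) * (g' : ℂ)) * (s * m : ℝ) * (s * ξ) +
          (C : ℂ) * (ξ * (-(r * m : ℝ) + l * Complex.I))) * starRingEnd ℂ ((C : ℂ) * (s * ξ))).im =
      A ^ 2 * (s * m) * (-(τ * H) + (H ^ 2 + τ ^ 2 * r ^ 2) * θ') - C ^ 2 * (s * l) := by
    intro A C θ' g'
    have e1 : (A : ℂ) * e * (-(Complex.I * τ) + (H - Complex.I * τ * r) *
        (Complex.I * (θ' : ℂ) - (g' : ℂ))) * (s * m : ℝ) *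
          starRingEnd ℂ ((A : ℂ) * (H - Complex.I * τ * r) * e) -
        (-((C : ℂ) * (g' : ℂ)) * (s * m : ℝ) * (s * ξ) +
          (C : ℂ) * (ξ * (-(r * m : ℝ) + l * Complex.I))) * starRingEnd ℂ ((C : ℂ) * (s * ξ)) =
        (A : ℂ) ^ 2 * (-(Complex.I * τ) + (H - Complex.I * τ * r) *
        (Complex.I * (θ' : ℂ) - (g' : ℂ))) * (s * m : ℝ) * (H + Complex.I * τ * r) -
        (-((C : ℂ) * (g' : ℂ)) * (s * m : ℝ) * s +
          (C : ℂ) * (-(r * m : ℝ) + l * Complex.I)) * (C * s) := by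
      simp only [map_mul, map_sub, Complex.conj_ofReal, Complex.conj_I]
      linear_combination (A : ℂ) ^ 2 * (-(Complex.I * τ) + (H - Complex.I * τ * r) *
        (Complex.I * (θ' : ℂ) - (g' : ℂ))) * (s * m : ℝ) * (H + Complex.I * τ * r) * he -
        (-((C : ℂ) * (g' : ℂ)) * (s * m : ℝ) * s +
          (C : ℂ) * (-(r * m : ℝ) + l * Complex.I)) * (C * s) * hξ'
    rw [e1]
    simp [pow_two]
    ring
  rw [key, div_pow, div_pow, hq2, hk]
  field_simp
  linear_combination -(4 * s * m * H * τ ^ 2) * hDr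

variable {ξ : ℂ} {s : ℝ} {p : Sphere}

lemma frameCoord_differential (hκ : κ < 0) (hτ : τ ≠ 0) (hHκ : 0 < 4 * H ^ 2 + κ)
    (hp : IsPolar p.1 ξ s) {u : TangentSpace (𝓡 2) p} {m l : ℝ}
    (h1 : (inclDeriv p u 0 + inclDeriv p u 1 * Complex.I : ℂ) =
      ξ * (-(p.1 2 * m : ℝ) + l * Complex.I)) (h2 : inclDeriv p u 2 = s * m) :
    frameCoord (sphereMap κ τ H p) (differential (sphereMap κ τ H) p u) =
      rotCoord κ τ (rotation κ τ H (p.1 2) ξ)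
        (((-(p.1 2 * meridianPart κ τ H (p.1 2) m l) : ℝ) : ℂ) +
          (parallelPart κ τ H (p.1 2) m l : ℝ) * Complex.I)
        (s * meridianPart κ τ H (p.1 2) m l) := by
  rw [frameCoord_eq, differential_sphereMap hκ hτ hHκ, rotCoord, h1, h2]
  simp only [sphereMap, ambientMap, hp.eq_mul]
  rw [horizontal_differential hκ hτ hHκ hp.sq_add_sq, vertical_differential hκ hτ hHκ _ _ _ _
    hp.norm_eq]

lemma normalCoord_eq_rotCoord (hp : IsPolar p.1 ξ s) :
    normalCoord κ τ H p = rotCoord κ τ (rotation κ τ H (p.1 2) ξ) (-s : ℝ) (-p.1 2) := by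
  have e : ambientNu κ τ H p = (√(-κ) / 2 : ℝ) * (rotation κ τ H (p.1 2) ξ * (-s : ℝ)) := by
    rw [ambientNu, nuProfile, rotation, hp.eq_mul]; push_cast; ring
  rw [normalCoord, rotCoord, e, show κ / (4 * τ) * p.1 2 = -κ / (4 * τ) * -p.1 2 by ring]

lemma dirDeriv_normalCoord_eq_rotCoord (hκ : κ < 0) (hτ : τ ≠ 0) (hHκ : 0 < 4 * H ^ 2 + κ)
    (hp : IsPolar p.1 ξ s) {u : TangentSpace (𝓡 2) p} {m l : ℝ}
    (h1 : (inclDeriv p u 0 + inclDeriv p u 1 * Complex.I : ℂ) =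
      ξ * (-(p.1 2 * m : ℝ) + l * Complex.I)) (h2 : inclDeriv p u 2 = s * m) :
    (fun k => dirDeriv (fun q => normalCoord κ τ H q k) p u) =
      rotCoord κ τ (rotation κ τ H (p.1 2) ξ)
        (((p.1 2 * m : ℝ) : ℂ) - ((l + s ^ 2 * m * (H * (4 * τ ^ 2 - κ) /
          (τ * profileDen κ τ H (p.1 2))) : ℝ) : ℂ) * Complex.I) (-(s * m)) := by
  rw [dirDeriv_normalCoord hκ hτ hHκ, (hasDerivAt_nuProfile hκ hτ hHκ _).deriv, h1, h2, hp.eq_mul,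
    rotCoord, show κ / (4 * τ) * (s * m) = -κ / (4 * τ) * -(s * m) by ring]
  have e : nuProfile κ τ H (p.1 2) * (Complex.I * ((H * (4 * τ ^ 2 - κ) /
      (τ * profileDen κ τ H (p.1 2)) : ℝ) : ℂ)) * (s * m : ℝ) * (s * ξ) +
      nuProfile κ τ H (p.1 2) * (ξ * (-(p.1 2 * m : ℝ) + l * Complex.I)) =
      (√(-κ) / 2 : ℝ) * (rotation κ τ H (p.1 2) ξ * (((p.1 2 * m : ℝ) : ℂ) -
        ((l + s ^ 2 * m * (H * (4 * τ ^ 2 - κ) /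
          (τ * profileDen κ τ H (p.1 2))) : ℝ) : ℂ) * Complex.I)) := by
    rw [nuProfile, rotation]
    generalize H * (4 * τ ^ 2 - κ) / (τ * profileDen κ τ H (p.1 2)) = θ'
    push_cast
    ring
  rw [e]

lemma rotCoord_add (Ω x x' : ℂ) (y y' : ℝ) :
    (fun k => rotCoord κ τ Ω x y k + rotCoord κ τ Ω x' y' k) =
      rotCoord κ τ Ω (x + x') (y + y') := by
  funext k
  fin_cases k <;> simp [rotCoord] <;> ring

/-- The connection in the normalised and rotated frame. -/
lemma conn_rotCoord (hκ : κ < 0) (hτ : τ ≠ 0) {Ω : ℂ} (hΩ : ‖Ω‖ = 1) (x x' : ℂ) (y y' : ℝ) :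
    (fun k => ∑ i, ∑ j, rotCoord κ τ Ω x y i * rotCoord κ τ Ω x' y' j * conn κ τ i j k) =
      rotCoord κ τ Ω (Complex.I * ((-(τ * y') : ℝ) * x + ((κ / (2 * τ) - τ) * y : ℝ) * x'))
        (τ * (x.re * x'.im - x.im * x'.re)) := by
  have hΩ2 : Ω.re * Ω.re + Ω.im * Ω.im = 1 := by
    rw [← Complex.normSq_apply, ← Complex.sq_norm, hΩ, one_pow]
  have hk : √(-κ) ^ 2 = -κ := sq_sqrt (by linarith)
  have h0 := hκ.ne
  obtain ⟨c, hc⟩ : ∃ c, c = κ / (2 * τ) - τ := ⟨_, rfl⟩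
  rw [← hc]
  funext k
  fin_cases k
  · simp [rotCoord, conn, Fin.sum_univ_three]
    rw [hc]
    field_simp
    ring
  · simp [rotCoord, conn, Fin.sum_univ_three]
    rw [hc]
    field_simp
    ring
  · simp [rotCoord, conn, Fin.sum_univ_three]
    field_simp
    linear_combination 4 * (x.re * x'.im - x.im * x'.re) * (Ω.re * Ω.re + Ω.im * Ω.im) * hk -
      4 * κ * (x.re * x'.im - x.im * x'.re) * hΩ2

/-- The vectors (-r, 0, s) and (0, 1, 0) are orthonormal because s² + r² = 1. -/
lemma metric_differential (hκ : κ < 0) (hτ : τ ≠ 0) (hHκ : 0 < 4 * H ^ 2 + κ)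
    (hp : IsPolar p.1 ξ s) {u v : TangentSpace (𝓡 2) p} {m l m' l' : ℝ}
    (h1 : (inclDeriv p u 0 + inclDeriv p u 1 * Complex.I : ℂ) =
      ξ * (-(p.1 2 * m : ℝ) + l * Complex.I)) (h2 : inclDeriv p u 2 = s * m)
    (h1' : (inclDeriv p v 0 + inclDeriv p v 1 * Complex.I : ℂ) =
      ξ * (-(p.1 2 * m' : ℝ) + l' * Complex.I)) (h2' : inclDeriv p v 2 = s * m') :
    metric κ τ (sphereMap κ τ H p) (differential (sphereMap κ τ H) p u)
      (differential (sphereMap κ τ H) p v) =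
      meridianPart κ τ H (p.1 2) m l * meridianPart κ τ H (p.1 2) m' l' +
        parallelPart κ τ H (p.1 2) m l * parallelPart κ τ H (p.1 2) m' l' := by
  rw [metric_of_rotCoord hκ hτ (norm_rotation _ hp.norm_eq)
    (frameCoord_differential hκ hτ hHκ hp h1 h2) (frameCoord_differential hκ hτ hHκ hp h1' h2')]
  simp
  linear_combination (meridianPart κ τ H (p.1 2) m l * meridianPart κ τ H (p.1 2) m' l') *
    hp.sq_add_sq

/-! ### Unit normal and immersion property -/

lemma metric_normal_differential (hκ : κ < 0) (hτ : τ ≠ 0) (hHκ : 0 < 4 * H ^ 2 + κ)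
    (p : Sphere) (u : TangentSpace (𝓡 2) p) :
    metric κ τ (sphereMap κ τ H p) (sphereNormal κ τ H p)
      (differential (sphereMap κ τ H) p u) = 0 := by
  obtain ⟨ξ, s, hp⟩ := exists_isPolar p
  obtain ⟨m, l, h1, h2⟩ := hp.exists_tangent (inclDeriv_orthogonal p u)
  rw [metric_of_rotCoord hκ hτ (norm_rotation _ hp.norm_eq)
    ((frameCoord_sphereNormal hκ hHκ p).trans (normalCoord_eq_rotCoord hp))
    (frameCoord_differential hκ hτ hHκ hp h1 h2)]
  simp
  ring

lemma metric_normal_normal (hκ : κ < 0) (hτ : τ ≠ 0) (hHκ : 0 < 4 * H ^ 2 + κ) (p : Sphere) :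
    metric κ τ (sphereMap κ τ H p) (sphereNormal κ τ H p) (sphereNormal κ τ H p) = 1 := by
  obtain ⟨ξ, s, hp⟩ := exists_isPolar p
  have h := (frameCoord_sphereNormal hκ hHκ p).trans (normalCoord_eq_rotCoord (H := H) (τ := τ) hp)
  rw [metric_of_rotCoord hκ hτ (norm_rotation _ hp.norm_eq) h h]
  simp
  linear_combination hp.sq_add_sq

lemma isUnitNormal_sphereNormal (hκ : κ < 0) (hτ : τ ≠ 0) (hHκ : 0 < 4 * H ^ 2 + κ) :
    IsUnitNormal κ τ (sphereMap κ τ H) (sphereNormal κ τ H) :=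
  ⟨contMDiff_sphereNormal hκ hHκ, fun p => ⟨isTangent_sum _ _, metric_normal_normal hκ hτ hHκ p,
    metric_normal_differential hκ hτ hHκ p⟩⟩

/-- The meridian and parallel parts determine the tangent vector. -/
lemma coords_of_parts (hκ : κ < 0) (hτ : τ ≠ 0) (hHκ : 0 < 4 * H ^ 2 + κ) (r m l : ℝ) :
    m = profileDen κ τ H r / (4 * (H ^ 2 + τ ^ 2)) * (H * meridianPart κ τ H r m l +
      τ * parallelPart κ τ H r m l) ∧
    l = H * parallelPart κ τ H r m l -
      (profileDen κ τ H r - 4 * H ^ 2) / (4 * τ) * meridianPart κ τ H r m l := by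
  have hD := profileDen_pos (τ := τ) hκ hHκ r
  have hK : H ^ 2 + τ ^ 2 ≠ 0 := by positivity
  simp only [meridianPart, parallelPart]
  generalize profileDen κ τ H r = D at hD
  constructor
  · field_simp
    ring
  · field_simp
    ring

/-- A kernel vector has α² + β² = 0, hence m = l = 0 by `coords_of_parts`; its image in ℝ³ vanishes,
and the inclusion of the sphere is an immersion. -/
lemma differential_sphereMap_injective (hκ : κ < 0) (hτ : τ ≠ 0) (hHκ : 0 < 4 * H ^ 2 + κ)
    (p : Sphere) : Function.Injective (differential (sphereMap κ τ H) p) := by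
  have hlin : ∀ u v, differential (sphereMap κ τ H) p (u - v) =
      differential (sphereMap κ τ H) p u - differential (sphereMap κ τ H) p v := fun u v =>
    map_sub (mfderiv (𝓡 2) 𝓘(ℝ, ℂ × ℂ) (sphereMap κ τ H) p) u v
  intro u v huv
  rw [← sub_eq_zero]
  have h0 : differential (sphereMap κ τ H) p (u - v) = 0 := by rw [hlin, huv, sub_self]
  generalize u - v = w at h0
  obtain ⟨ξ, s, hp⟩ := exists_isPolar p
  obtain ⟨m, l, h1, h2⟩ := hp.exists_tangent (inclDeriv_orthogonal p w)
  have hm := metric_differential hκ hτ hHκ hp h1 h2 h1 h2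
  have hz : metric κ τ (sphereMap κ τ H p) 0 0 = 0 := by simp [metric, frameCoord, neutral, Fin.sum_univ_three]
  rw [h0, hz] at hm
  have ha : meridianPart κ τ H (p.1 2) m l = 0 := by nlinarith
  have hb : parallelPart κ τ H (p.1 2) m l = 0 := by nlinarith
  obtain ⟨em, el⟩ := coords_of_parts hκ hτ hHκ (p.1 2) m l
  rw [ha, hb] at em el
  have hm0 : m = 0 := by simpa using em
  have hl0 : l = 0 := by simpa using el
  rw [hm0, hl0] at h1
  rw [hm0, mul_zero] at h2
  have e0 : inclDeriv p w 0 = 0 := by simpa using congrArg Complex.re h1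
  have e1 : inclDeriv p w 1 = 0 := by simpa using congrArg Complex.im h1
  have e : inclDeriv p w = inclDeriv p 0 := by
    have hz : inclDeriv p 0 = 0 := map_zero (mfderiv (𝓡 2) 𝓘(ℝ, EuclideanSpace ℝ (Fin 3))
      ((↑) : Sphere → EuclideanSpace ℝ (Fin 3)) p)
    rw [hz]
    ext i
    fin_cases i
    · exact e0
    · exact e1
    · exact h2
  exact inclDeriv_injective p e

lemma isSmoothImmersion_sphereMap (hκ : κ < 0) (hτ : τ ≠ 0) (hHκ : 0 < 4 * H ^ 2 + κ) :
    IsSmoothImmersion (sphereMap κ τ H) :=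
  ⟨sphereMap_mem hκ hHκ, contMDiff_sphereMap hκ hHκ, differential_sphereMap_injective hκ hτ hHκ⟩

/-! ### Shape operator and mean curvature -/

lemma frameCoord_covDeriv (hκ : κ < 0) (hτ : τ ≠ 0) (hHκ : 0 < 4 * H ^ 2 + κ)
    (hp : IsPolar p.1 ξ s) {u : TangentSpace (𝓡 2) p} {m l : ℝ}
    (h1 : (inclDeriv p u 0 + inclDeriv p u 1 * Complex.I : ℂ) =
      ξ * (-(p.1 2 * m : ℝ) + l * Complex.I)) (h2 : inclDeriv p u 2 = s * m) :
    frameCoord (sphereMap κ τ H p)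
      (covDeriv κ τ (sphereMap κ τ H) (sphereNormal κ τ H) p u) =
    rotCoord κ τ (rotation κ τ H (p.1 2) ξ)
      (((p.1 2 * (m - τ * parallelPart κ τ H (p.1 2) m l) : ℝ) : ℂ) -
        ((l + s ^ 2 * m * (H * (4 * τ ^ 2 - κ) / (τ * profileDen κ τ H (p.1 2))) +
          (τ * p.1 2 ^ 2 + (κ / (2 * τ) - τ) * s ^ 2) * meridianPart κ τ H (p.1 2) m l : ℝ) : ℂ) *
            Complex.I)
      (-(s * (m - τ * parallelPart κ τ H (p.1 2) m l))) := by
  rw [covDeriv, frameCoord_sum (sphereMap_mem hκ hHκ p)]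
  simp only [frameCoord_sphereNormal hκ hHκ]
  have e1 := dirDeriv_normalCoord_eq_rotCoord hκ hτ hHκ hp h1 h2
  have e2 := conn_rotCoord hκ hτ (norm_rotation (κ := κ) (τ := τ) (H := H) (p.1 2) hp.norm_eq)
    (((-(p.1 2 * meridianPart κ τ H (p.1 2) m l) : ℝ) : ℂ) +
          (parallelPart κ τ H (p.1 2) m l : ℝ) * Complex.I) (-s : ℝ)
    (s * meridianPart κ τ H (p.1 2) m l) (-p.1 2)
  rw [← frameCoord_differential hκ hτ hHκ hp h1 h2, ← normalCoord_eq_rotCoord hp] at e2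
  -- Derivative of the coordinates of N plus connection term. The sum is a combination of (-r, 0, s)
  -- and (0, 1, 0): it has no normal component, as N has unit length.
  have e3 := congrArg₂ (fun f g : Fin 3 → ℝ => fun k => f k + g k) e1 e2
  rw [rotCoord_add] at e3
  refine e3.trans ?_
  congr 1
  · generalize H * (4 * τ ^ 2 - κ) / (τ * profileDen κ τ H (p.1 2)) = θ'
    push_cast
    linear_combination (τ * p.1 2 * parallelPart κ τ H (p.1 2) m l : ℂ) * Complex.I_sq
  · simp
    ring

lemma secondFundamentalForm_eq (hκ : κ < 0) (hτ : τ ≠ 0) (hHκ : 0 < 4 * H ^ 2 + κ)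
    (hp : IsPolar p.1 ξ s) {u : TangentSpace (𝓡 2) p} {m l : ℝ}
    (h1 : (inclDeriv p u 0 + inclDeriv p u 1 * Complex.I : ℂ) =
      ξ * (-(p.1 2 * m : ℝ) + l * Complex.I)) (h2 : inclDeriv p u 2 = s * m) :
    secondFundamentalForm κ τ (sphereMap κ τ H) (sphereNormal κ τ H) p u u =
      (m - τ * parallelPart κ τ H (p.1 2) m l) * meridianPart κ τ H (p.1 2) m l +
      (l + s ^ 2 * m * (H * (4 * τ ^ 2 - κ) / (τ * profileDen κ τ H (p.1 2))) +
          (τ * p.1 2 ^ 2 + (κ / (2 * τ) - τ) * s ^ 2) * meridianPart κ τ H (p.1 2) m l) *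
        parallelPart κ τ H (p.1 2) m l := by
  rw [secondFundamentalForm, metric_of_rotCoord hκ hτ (norm_rotation _ hp.norm_eq)
    (frameCoord_covDeriv hκ hτ hHκ hp h1 h2) (frameCoord_differential hκ hτ hHκ hp h1 h2)]
  simp only [Complex.add_re, Complex.add_im, Complex.sub_re, Complex.sub_im, Complex.mul_re,
    Complex.mul_im, Complex.ofReal_re, Complex.ofReal_im, Complex.I_re, Complex.I_im]
  linear_combination ((m - τ * parallelPart κ τ H (p.1 2) m l) *
    meridianPart κ τ H (p.1 2) m l) * hp.sq_add_sq

/-- The rows of an orthogonal matrix are orthonormal if its columns are. -/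
lemma orthonormal_transpose {a b a' b' : ℝ} (h1 : a * a + b * b = 1) (h2 : a' * a' + b' * b' = 1)
    (h3 : a * a' + b * b' = 0) :
    a * a + a' * a' = 1 ∧ b * b + b' * b' = 1 ∧ a * b + a' * b' = 0 := by
  have h : !![a, b; a', b'] * !![a, a'; b, b'] = 1 := by
    rw [Matrix.mul_fin_two, Matrix.one_fin_two, h1, h2, h3, mul_comm a' a, mul_comm b' b, h3]
  have h' := mul_eq_one_comm.1 h
  rw [Matrix.mul_fin_two, Matrix.one_fin_two] at h'
  have e := fun i j => congrFun (congrFun h' i) j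
  exact ⟨by simpa using e 0 0, by simpa using e 1 1, by simpa using e 0 1⟩

lemma hasMeanCurvature_sphereMap (hκ : κ < 0) (hτ : τ ≠ 0) (hH : 0 < H)
    (hHκ : 0 < 4 * H ^ 2 + κ) : HasMeanCurvature κ τ H (sphereMap κ τ H) := by
  refine ⟨_, isUnitNormal_sphereNormal hκ hτ hHκ, fun p u v hu hv huv => ?_⟩
  obtain ⟨ξ, s, hp⟩ := exists_isPolar p
  obtain ⟨m, l, h1, h2⟩ := hp.exists_tangent (inclDeriv_orthogonal p u)
  obtain ⟨m', l', h1', h2'⟩ := hp.exists_tangent (inclDeriv_orthogonal p v)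
  rw [metric_differential hκ hτ hHκ hp h1 h2 h1 h2] at hu
  rw [metric_differential hκ hτ hHκ hp h1' h2' h1' h2'] at hv
  rw [metric_differential hκ hτ hHκ hp h1 h2 h1' h2'] at huv
  rw [secondFundamentalForm_eq hκ hτ hHκ hp h1 h2, secondFundamentalForm_eq hκ hτ hHκ hp h1' h2']
  obtain ⟨t1, t2, t3⟩ := orthonormal_transpose hu hv huv
  obtain ⟨em, el⟩ := coords_of_parts hκ hτ hHκ (p.1 2) m l
  obtain ⟨em', el'⟩ := coords_of_parts hκ hτ hHκ (p.1 2) m' l'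
  have hg := profileDen_add (κ := κ) (τ := τ) (H := H) hp.sq_add_sq
  have hD := profileDen_pos (τ := τ) hκ hHκ (p.1 2)
  have hK : H ^ 2 + τ ^ 2 ≠ 0 := by positivity
  generalize meridianPart κ τ H (p.1 2) m l = a at *
  generalize parallelPart κ τ H (p.1 2) m l = b at *
  generalize meridianPart κ τ H (p.1 2) m' l' = a' at *
  generalize parallelPart κ τ H (p.1 2) m' l' = b' at *
  -- This coefficient only multiplies Σαβ = 0 in the trace, so its value is irrelevant.
  generalize (τ * p.1 2 ^ 2 + (κ / (2 * τ) - τ) * s ^ 2) = c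
  generalize profileDen κ τ H (p.1 2) = D at *
  have q1 : m * a + m' * a' = D * H / (4 * (H ^ 2 + τ ^ 2)) := by
    rw [em, em']
    linear_combination D / (4 * (H ^ 2 + τ ^ 2)) * (H * t1 + τ * t3)
  have q2 : m * b + m' * b' = D * τ / (4 * (H ^ 2 + τ ^ 2)) := by
    rw [em, em']
    linear_combination D / (4 * (H ^ 2 + τ ^ 2)) * (H * t3 + τ * t2)
  have q3 : l * b + l' * b' = H := by
    rw [el, el']
    linear_combination H * t2 - (D - 4 * H ^ 2) / (4 * τ) * t3
  have q4 : s ^ 2 * (H * (4 * τ ^ 2 - κ) / (τ * D)) = H * (4 * (H ^ 2 + τ ^ 2) - D) / (τ * D) := by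
    rw [← hg]; ring
  -- The trace is Σmα + Σlβ + s²θ' Σmβ. Its first and third terms add up to H, since the parts
  -- containing D cancel.
  have q5 : D * H / (4 * (H ^ 2 + τ ^ 2)) + H +
      H * (4 * (H ^ 2 + τ ^ 2) - D) / (τ * D) * (D * τ / (4 * (H ^ 2 + τ ^ 2))) = 2 * H := by
    field_simp
    ring
  rw [← q1, ← q2, ← q4] at q5
  generalize H * (4 * τ ^ 2 - κ) / (τ * D) = θ' at *
  linear_combination q5 / 2 + q3 / 2 + (c - τ) / 2 * t3

/-! ### The explicit parametrization -/

lemma zProfile_rho (hκ : κ < 0) (hH : 0 < H) (hHκ : 0 < 4 * H ^ 2 + κ) {x : ℝ}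
    (hx : x ∈ Set.Ioc 0 (halfLength κ H)) :
    zProfile κ τ H (rho κ τ H x) =
      (cosh x : ℂ) * Complex.exp (-(Complex.I * (yFun κ τ H x : ℂ))) := by
  rw [zProfile_eq hH, ← cosh_eq hκ hH hHκ hx, yFun_eq]

lemma zProfile_neg_rho (hκ : κ < 0) (hH : 0 < H) (hHκ : 0 < 4 * H ^ 2 + κ) {x : ℝ}
    (hx : x ∈ Set.Ioc 0 (halfLength κ H)) :
    zProfile κ τ H (-rho κ τ H x) =
      (cosh x : ℂ) * Complex.exp (Complex.I * (yFun κ τ H x : ℂ)) := by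
  have e : profileDen κ τ H (-rho κ τ H x) = profileDen κ τ H (rho κ τ H x) := by
    simp [profileDen]
  rw [zProfile_eq hH, e, neg_sq, ← cosh_eq hκ hH hHκ hx, yFun_eq, angle_neg]
  push_cast
  ring_nf

lemma wProfile_mul (hκ : κ < 0) (hH : 0 < H) (hHκ : 0 < 4 * H ^ 2 + κ) {x r t : ℝ}
    (hx : x ∈ Set.Ioc 0 (halfLength κ H)) (hr : r = rho κ τ H x ∨ r = -rho κ τ H x) :
    wProfile κ τ H r * (((√(1 - r ^ 2) * cos t : ℝ) : ℂ) +
      ((√(1 - r ^ 2) * sin t : ℝ) : ℂ) * Complex.I) =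
      (sinh x : ℂ) * Complex.exp (Complex.I * (t : ℂ)) := by
  have h2 : r ^ 2 = rho κ τ H x ^ 2 := by rcases hr with h | h <;> rw [h]; ring
  have e : profileDen κ τ H r = profileDen κ τ H (rho κ τ H x) := by
    rw [profileDen, h2, profileDen]
  rw [wProfile, e, h2, mul_comm Complex.I, Complex.exp_mul_I,
    sinh_eq (τ := τ) hκ hH hHκ hx]
  push_cast
  ring

lemma sphereMap_latLong (hκ : κ < 0) (hH : 0 < H) (hHκ : 0 < 4 * H ^ 2 + κ) {x : ℝ}
    (hx : x ∈ Set.Ioo (-halfLength κ H) (halfLength κ H)) (t : ℝ) :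
    sphereMap κ τ H (latLong (arcsin (height κ τ H x)) t) = Phi κ τ H x t := by
  have hm := height_mem (τ := τ) hκ hH hHκ hx
  have e : sphereMap κ τ H (latLong (arcsin (height κ τ H x)) t) =
      (zProfile κ τ H (height κ τ H x), wProfile κ τ H (height κ τ H x) *
        (((√(1 - height κ τ H x ^ 2) * cos t : ℝ) : ℂ) +
          ((√(1 - height κ τ H x ^ 2) * sin t : ℝ) : ℂ) * Complex.I)) := by
    simp [sphereMap, ambientMap, latLong, sin_arcsin hm.1.le hm.2.le, cos_arcsin]
  rw [e, Phi]
  split_ifs with h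
  · have hx' : x + halfLength κ H ∈ Set.Ioc 0 (halfLength κ H) :=
      ⟨by linarith [hx.1], by linarith⟩
    have hh := height_of_nonpos (κ := κ) (τ := τ) (H := H) h.le
    rw [wProfile_mul hκ hH hHκ hx' (Or.inr hh), hh, zProfile_neg_rho hκ hH hHκ hx']
  · have hx' : halfLength κ H - x ∈ Set.Ioc 0 (halfLength κ H) :=
      ⟨by linarith [hx.2], by linarith⟩
    -- At x = 0 the case distinctions in `Phi` and `height` choose opposite branches; they agree
    -- because ρ(a) = 0.
    have hh := height_of_nonneg (τ := τ) hκ hH hHκ (not_lt.1 h)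
    rw [wProfile_mul hκ hH hHκ hx' (Or.inl hh), hh, zProfile_rho hκ hH hHκ hx']

/-! ### Embeddedness -/

lemma sphereMap_injective (hκ : κ < 0) (hτ : τ ≠ 0) (hH : 0 < H) (hHκ : 0 < 4 * H ^ 2 + κ)
    (h : |angle κ τ H 1| < π) : Function.Injective (sphereMap κ τ H) := by
  intro p q hpq
  have hp := sphere_sq_sum p
  have hq := sphere_sq_sum q
  have hz : zProfile κ τ H (p.1 2) = zProfile κ τ H (q.1 2) := congrArg Prod.fst hpq
  have hw : wProfile κ τ H (p.1 2) * (p.1 0 + p.1 1 * Complex.I) =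
      wProfile κ τ H (q.1 2) * (q.1 0 + q.1 1 * Complex.I) := congrArg Prod.snd hpq
  have hDp := profileDen_pos (τ := τ) hκ hHκ (p.1 2)
  have hDq := profileDen_pos (τ := τ) hκ hHκ (q.1 2)
  have hsq : p.1 2 ^ 2 = q.1 2 ^ 2 := by
    have e := norm_wProfile_sq (τ := τ) hκ hHκ hp
    rw [hw, norm_wProfile_sq hκ hHκ hq, div_eq_div_iff hDq.ne' hDp.ne'] at e
    -- As a function of r², |w|² = -κ(1 - r²)/D is a Möbius map; this constant is, up to sign, its
    -- determinant, so r² can be recovered.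
    have hK : -κ * (4 * (H ^ 2 + τ ^ 2)) ≠ 0 :=
      mul_ne_zero (neg_ne_zero.2 hκ.ne) (by positivity)
    simp only [profileDen] at e
    refine mul_left_cancel₀ hK ?_
    linear_combination e
  have hD : profileDen κ τ H (p.1 2) = profileDen κ τ H (q.1 2) := by
    rw [profileDen, hsq, profileDen]
  have h2 : p.1 2 = q.1 2 := by
    rcases sq_eq_sq_iff_eq_or_eq_neg.1 hsq with h' | h'
    · exact h'
    · have hE : 0 < H ^ 2 + τ ^ 2 * q.1 2 ^ 2 := by positivity
      rw [zProfile_eq hH, zProfile_eq hH, hD, hsq, h', angle_neg] at hz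
      have hC : ((2 * √(H ^ 2 + τ ^ 2 * q.1 2 ^ 2) / √(profileDen κ τ H (q.1 2)) : ℝ) : ℂ) ≠ 0 :=
        Complex.ofReal_ne_zero.2 (by positivity)
      -- At opposite heights the moduli of z agree and e^{iY} = e^{-iY}. The imaginary part gives
      -- sin Y = 0, and |Y| < π leaves only Y = 0, that is r = 0.
      have e := congrArg Complex.im (mul_left_cancel₀ hC hz)
      have e1 : -(Complex.I * ((-angle κ τ H (q.1 2) : ℝ) : ℂ)) =
          ((angle κ τ H (q.1 2) : ℝ) : ℂ) * Complex.I := by push_cast; ring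
      have e2 : -(Complex.I * ((angle κ τ H (q.1 2) : ℝ) : ℂ)) =
          ((-angle κ τ H (q.1 2) : ℝ) : ℂ) * Complex.I := by push_cast; ring
      rw [e1, e2, Complex.exp_ofReal_mul_I_im, Complex.exp_ofReal_mul_I_im, sin_neg] at e
      have hq1 : |q.1 2| ≤ 1 := by
        rw [← sq_le_one_iff_abs_le_one]; nlinarith [sq_nonneg (q.1 0), sq_nonneg (q.1 1)]
      have hlt := abs_lt.1 ((abs_angle_le hκ hτ hH hHκ hq1).trans_lt h)
      have h0 : angle κ τ H (q.1 2) = 0 :=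
        (sin_eq_zero_iff_of_lt_of_lt hlt.1 hlt.2).1 (by linarith)
      have h3 : q.1 2 = 0 := angle_injective hκ hτ hH hHκ (h0.trans angle_zero.symm)
      rw [h', h3, neg_zero]
  have hW : wProfile κ τ H (q.1 2) ≠ 0 :=
    Complex.ofReal_ne_zero.2
      (div_pos (sqrt_pos.2 (by linarith)) (sqrt_pos.2 hDq)).ne'
  rw [h2] at hw
  have h01 := mul_left_cancel₀ hW hw
  have h0 : p.1 0 = q.1 0 := by simpa using congrArg Complex.re h01
  have h1 : p.1 1 = q.1 1 := by simpa using congrArg Complex.im h01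
  apply Subtype.ext
  ext i
  fin_cases i
  · exact h0
  · exact h1
  · exact h2

/-- If |Y(1)| ≥ π, the intermediate value theorem gives r in [0, 1] with |Y(r)| = π. Then z takes
the same value at heights ±r, so the points of longitude 0 at these heights collide; r ≠ 0 because
Y(0) = 0. -/
lemma abs_angle_lt_of_injective (hH : 0 < H)
    (h : Function.Injective (sphereMap κ τ H)) : |angle κ τ H 1| < π := by
  by_contra hcon
  have hcont : ContinuousOn (fun r => |angle κ τ H r|) (Set.Icc 0 1) :=
    continuous_angle.abs.continuousOn
  have hivt := intermediate_value_Icc zero_le_one hcont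
  obtain ⟨r, hr, e⟩ := hivt (show π ∈ _ from ⟨by simp [angle_zero, pi_pos.le], not_lt.1 hcon⟩)
  have hs : sin (arcsin r) = r := sin_arcsin (by linarith [hr.1]) hr.2
  have hz : zProfile κ τ H (-r) = zProfile κ τ H r := by
    rw [zProfile_eq hH, zProfile_eq hH, angle_neg]
    have hD : profileDen κ τ H (-r) = profileDen κ τ H r := by simp [profileDen]
    rw [hD, neg_sq]
    congr 1
    rcases abs_eq_abs.1 (e.trans (abs_of_pos pi_pos).symm) with h' | h' <;> rw [h'] <;>
      simp [mul_comm Complex.I, Complex.exp_neg, Complex.exp_pi_mul_I]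
  have heq : sphereMap κ τ H (latLong (-arcsin r) 0) = sphereMap κ τ H (latLong (arcsin r) 0) := by
    have hw : wProfile κ τ H (-r) = wProfile κ τ H r := by simp [wProfile, profileDen]
    simp [sphereMap, ambientMap, latLong, hs, hz, hw]
  have h2 := congrArg (fun p : Sphere => p.1 2) (h heq)
  simp [latLong, hs] at h2
  have hr0 : r = 0 := by linarith
  rw [hr0] at e
  simp [angle_zero] at e
  exact pi_ne_zero e.symm

lemma isSmoothEmbedding_iff (hκ : κ < 0) (hτ : τ ≠ 0) (hH : 0 < H) (hHκ : 0 < 4 * H ^ 2 + κ) :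
    IsSmoothEmbedding (sphereMap κ τ H) ↔ |angle κ τ H 1| < π := by
  constructor
  · exact fun h => abs_angle_lt_of_injective hH h.2.injective
  · exact fun h => ⟨isSmoothImmersion_sphereMap hκ hτ hHκ,
      -- A continuous injection of a compact space into a Hausdorff space is a closed embedding.
      ((contMDiff_sphereMap hκ hHκ).continuous.isClosedEmbedding
        (sphereMap_injective hκ hτ hH hHκ h)).isEmbedding⟩

end SlTwo

theorem mainTheorem4 (κ τ H : ℝ) (hκ : κ < 0) (hτ : τ ≠ 0) (hH : 0 < H)
    (hHκ : 0 < 4 * H ^ 2 + κ) :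
    ∃ (φ : ℝ → ℝ) (F : SlTwo.Sphere → ℂ × ℂ),
      SlTwo.IsLatitude (SlTwo.halfLength κ H) φ ∧
      (∀ x ∈ Set.Ioo (-SlTwo.halfLength κ H) (SlTwo.halfLength κ H),
        ∀ t ∈ Set.Ioo (-Real.pi) Real.pi,
          F (SlTwo.latLong (φ x) t) = SlTwo.Phi κ τ H x t) ∧
      SlTwo.IsSmoothImmersion F ∧
      SlTwo.HasMeanCurvature κ τ H F ∧
      (0 < τ → (SlTwo.IsSmoothEmbedding F ↔ -Real.pi < SlTwo.yFun κ τ H 0)) ∧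
      (τ < 0 → (SlTwo.IsSmoothEmbedding F ↔ SlTwo.yFun κ τ H 0 < Real.pi)) := by
  refine ⟨fun x => Real.arcsin (SlTwo.height κ τ H x), SlTwo.sphereMap κ τ H,
    SlTwo.isLatitude_arcsin_height hκ hH hHκ,
    fun x hx t _ => SlTwo.sphereMap_latLong hκ hH hHκ hx t,
    SlTwo.isSmoothImmersion_sphereMap hκ hτ hHκ, SlTwo.hasMeanCurvature_sphereMap hκ hτ hH hHκ,
    fun h => ?_, fun h => ?_⟩
  -- Since ρ(0) = 1, y(0) = Y(1), which is negative for τ > 0 and positive for τ < 0; only one side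
  -- of |Y(1)| < π is then a condition.
  · have h1 := SlTwo.strictAnti_angle hκ h hH hHκ one_pos
    rw [SlTwo.angle_zero] at h1
    rw [SlTwo.isSmoothEmbedding_iff hκ hτ hH hHκ, SlTwo.yFun_eq, SlTwo.rho_zero, abs_of_neg h1,
      neg_lt]
  · have h1 := SlTwo.strictMono_angle hκ h hH hHκ one_pos
    rw [SlTwo.angle_zero] at h1
    rw [SlTwo.isSmoothEmbedding_iff hκ hτ hH hHκ, SlTwo.yFun_eq, SlTwo.rho_zero, abs_of_pos h1]
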